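/- Let $a>0$, $b<0$. For $\varepsilon,d_1,\dots,d_6\in\mathbb R$ consider the planar system $$\dot x=y,\qquad \dot y=-x-\frac{2b}{a^2}x^3+\varepsilon Q_1(x,y),\qquad Q_1(x,y)=(d_3+d_2x^2+d_1x^4+d_4y^2+d_5x^6+d_6y^4)\,y,$$ with the equilibria $p_1=\left(\frac{a}{\sqrt{-2b}},0\right)$ and $p_2=\left(-\frac{a}{\sqrt{-2b}},0\right)$. For $\varepsilon=0$ it has the heteroclinic loop $A=\{p_1\}\cup A_1\cup\{p_2\}\cup A_2$, where, for $|x|<\frac{a}{\sqrt{-2b}}$, $A_1$ is the arc $y=y(x)=-\sqrt{\frac{-b}{a^2}}\,x^2+\sqrt{\frac{a^2}{-4b}}$ and $A_2$ is the arc $y=-y(x)$. A heteroclinic loop of the system is a set consisting of $p_1$, $p_2$, an orbit from $p_2$ to $p_1$ and an orbit from $p_1$ to $p_2$. Two sets are $\delta$-close if each lies in the open $\delta$-neighbourhood of the other. Put $$\varphi_1^0=-\frac{12d_4}{7}-\frac{5a^4d_5}{84b^2}+\frac{a^2(99d_1+160d_6)}{462b}+\frac{10bd_3}{a^2}.$$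 (i) The first-order Melnikov integral $M_1=\int_{A_1}Q_1\,dx$, with $A_1$ oriented by the flow (from $p_2$ to $p_1$), equals $$M_1=\frac{1}{13860\sqrt2\,b^4}\left(-198a^6b\,d_1+924a^4b^2d_2-9240a^2b^3d_3+1584a^4b^2d_4+55a^8d_5-320a^6b\,d_6\right).$$ (ii) $M_1=0$ if and only if $d_2=\varphi_1^0(d_1,d_3,d_4,d_5,d_6)$. (iii) There is a function $\varphi_1(d_1,d_3,d_4,d_5,d_6,\varepsilon)$ with $\varphi_1=\varphi_1^0(d_1,d_3,d_4,d_5,d_6)+O(\varepsilon)$ as $\varepsilon\to0$, uniformly for $(d_1,d_3,d_4,d_5,d_6)$ in bounded sets, such that the system has a heteroclinic loop close to $A$ if and only if $d_2=\varphi_1(d_1,d_3,d_4,d_5,d_6,\varepsilon)$. More precisely: there is $\delta_0>0$ such that for every $\delta\in(0,\delta_0]$ and every $R>0$ there is $\varepsilon_0>0$ such that, whenever $|d_i|\le R$ for $i=1,\dots,6$ and $0<|\varepsilon|<\varepsilon_0$, the system has a heteroclinic loop that is $\delta$-close to $A$ if and only if $d_2=\varphi_1(d_1,d_3,d_4,d_5,d_6,\varepsilon)$.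 -/

import Mathlib

open Filter Topology

/-- The perturbation
`Q₁(x, y) = (d₃ + d₂ x² + d₁ x⁴ + d₄ y² + d₅ x⁶ + d₆ y⁴) y`. -/
def perturbQ (d1 d2 d3 d4 d5 d6 x y : ℝ) : ℝ :=
  (d3 + d2 * x ^ 2 + d1 * x ^ 4 + d4 * y ^ 2 + d5 * x ^ 6 + d6 * y ^ 4) * y

/-- The vector field of the canonical form
`x' = y`, `y' = -x - (2b/a²) x³ + ε Q₁(x, y)`. -/
noncomputable def canonicalField (a b ε d1 d2 d3 d4 d5 d6 : ℝ) (p : ℝ × ℝ) : ℝ × ℝ :=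
  (p.2, -p.1 - 2 * b / a ^ 2 * p.1 ^ 3 + ε * perturbQ d1 d2 d3 d4 d5 d6 p.1 p.2)

/-- The abscissa `a / √(-2b)` of the right saddle. -/
noncomputable def saddleX (a b : ℝ) : ℝ := a / √(-(2 * b))

/-- The right saddle. -/
noncomputable def rightSaddle (a b : ℝ) : ℝ × ℝ := (saddleX a b, 0)

/-- The left saddle. -/
noncomputable def leftSaddle (a b : ℝ) : ℝ × ℝ := (-saddleX a b, 0)

/-- The height `y(x) = -√(-b/a²) x² + √(a²/(-4b))` of the upper unperturbed arc. -/
noncomputable def arcHeight (a b x : ℝ) : ℝ := -√(-b / a ^ 2) * x ^ 2 + √(a ^ 2 / (-(4 * b)))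

/-- The upper arc `A₁` of the unperturbed loop (run through from left to right by the flow). -/
def upperArc (a b : ℝ) : Set (ℝ × ℝ) :=
  {p | |p.1| < saddleX a b ∧ p.2 = arcHeight a b p.1}

/-- The lower arc `A₂` of the unperturbed loop. -/
def lowerArc (a b : ℝ) : Set (ℝ × ℝ) :=
  {p | |p.1| < saddleX a b ∧ p.2 = -arcHeight a b p.1}

/-- The unperturbed loop `A = {p₁} ∪ A₁ ∪ {p₂} ∪ A₂`. -/
def unperturbedLoop (a b : ℝ) : Set (ℝ × ℝ) :=
  {rightSaddle a b} ∪ upperArc a b ∪ {leftSaddle a b} ∪ lowerArc a b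

/-- `γ` is a solution of `z' = X z`, defined for all times, that tends to `p` as `t → -∞` and
to `q` as `t → +∞`. -/
def IsConnection (X : ℝ × ℝ → ℝ × ℝ) (p q : ℝ × ℝ) (γ : ℝ → ℝ × ℝ) : Prop :=
  (∀ t, HasDerivAt γ (X (γ t)) t) ∧ Tendsto γ atBot (𝓝 p) ∧ Tendsto γ atTop (𝓝 q)

/-- `L` is a heteroclinic loop of `X` through the distinct equilibria `p₁` and `p₂`: these two
points, an orbit from `p₂` to `p₁`, and an orbit from `p₁` to `p₂`. -/
def IsHeteroclinicLoop (X : ℝ × ℝ → ℝ × ℝ) (p₁ p₂ : ℝ × ℝ) (L : Set (ℝ × ℝ)) : Prop :=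
  p₁ ≠ p₂ ∧ X p₁ = 0 ∧ X p₂ = 0 ∧
    ∃ γ₁ γ₂ : ℝ → ℝ × ℝ, IsConnection X p₂ p₁ γ₁ ∧ IsConnection X p₁ p₂ γ₂ ∧
      L = {p₁} ∪ Set.range γ₁ ∪ {p₂} ∪ Set.range γ₂

/-- Two plane sets are `δ`-close (in the Hausdorff sense): each one lies in the open
`δ`-neighbourhood of the other. -/
def SetsClose (δ : ℝ) (K L : Set (ℝ × ℝ)) : Prop :=
  K ⊆ Metric.thickening δ L ∧ L ⊆ Metric.thickening δ K

/-- The first order Melnikov integral `∫_{A₁} Q₁ dx`, the arc `A₁` being parametrized by `x` in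
the direction of the flow. -/
noncomputable def melnikovOne (a b d1 d2 d3 d4 d5 d6 : ℝ) : ℝ :=
  ∫ x in (-saddleX a b)..(saddleX a b), perturbQ d1 d2 d3 d4 d5 d6 x (arcHeight a b x)

/-- The leading part of `φ₁`. -/
noncomputable def phiLead (a b d1 d3 d4 d5 d6 : ℝ) : ℝ :=
  -(12 * d4 / 7) - 5 * a ^ 4 * d5 / (84 * b ^ 2) + a ^ 2 * (99 * d1 + 160 * d6) / (462 * b)
    + 10 * b * d3 / a ^ 2

/-! With `r = saddleX a b` the system becomes a damped field with saddles at `±r`, and `A₁` is the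
graph of `arcProfile κ r x = κ (r² - x²)`, where `2 κ² r² = 1`. The field is odd, so rotation by `π`
turns a connection from left to right into one from right to left. A loop therefore exists as soon
as one upper connection exists.

A connection on which the damping is small stays in the upper half plane (`IsConnection.snd_pos`)
and is a graph `y = U x` (`IsConnection.exists_graph`). The equation for `U²` integrates to an
energy balance (`graph_sq_eq`). Write `U = arcProfile · S`. Vanishing of the total energy gain is
linear in `d₂` and determines `d₂ = balanceCoeff S`; what remains is the fixed point equation `S =
profileMap S`. The gain is divided there by `arcProfile²`, which vanishes at both saddles. The
quotient stays bounded because the integrand has a factor `arcProfile` and the total gain is zero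
(`abs_integral_le`).

For small `ε` the map contracts the profiles with values in `[1/2, 2]`, so there is exactly one `S`,
and `φ₁` is its balancing coefficient. Every connection in a fixed bounded region yields such a
profile (`graph_bound`, `exists_profile_of_connection`), and conversely the fixed point carries a
connection (`exists_connection_of_profile`). Since `S = 1 + O(ε)` and the coefficient is Lipschitz
in `S`, `φ₁` is `O(ε)`-close to its value at `S = 1`. That value is the zero of the Melnikov
integral (`balanceCoeff_one`). -/

/-- The field `x' = y`, `y' = -x + x³ / r² + G(x, y) y`. -/
noncomputable def dampedField (r : ℝ) (G : ℝ × ℝ → ℝ) (p : ℝ × ℝ) : ℝ × ℝ :=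
  (p.2, -p.1 + p.1 ^ 3 / r ^ 2 + G p * p.2)

/-! ### Uniqueness of solutions and injectivity of connections -/

theorem contDiff_dampedField {r : ℝ} {G : ℝ × ℝ → ℝ} (hG : ContDiff ℝ 1 G) :
    ContDiff ℝ 1 (dampedField r G) := by
  unfold dampedField
  fun_prop

/-- A `C¹` field is Lipschitz on balls, and over a compact time interval both curves stay in one
ball, so local uniqueness suffices. -/
theorem solution_eq_of_eq_at {V : ℝ × ℝ → ℝ × ℝ} (hV : ContDiff ℝ 1 V) {α β : ℝ → ℝ × ℝ}
    (hα : ∀ t, HasDerivAt α (V (α t)) t) (hβ : ∀ t, HasDerivAt β (V (β t)) t) {t₀ : ℝ}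
    (h : α t₀ = β t₀) : α = β := by
  ext1 t
  have cα : Continuous α := continuous_iff_continuousAt.2 fun t => (hα t).continuousAt
  have cβ : Continuous β := continuous_iff_continuousAt.2 fun t => (hβ t).continuousAt
  set A := min t t₀ - 1
  set B := max t t₀ + 1
  have hA : A < t ∧ A < t₀ := ⟨by simp [A]; grind, by simp [A]; grind⟩
  have hB : t < B ∧ t₀ < B := ⟨by simp [B]; grind, by simp [B]; grind⟩
  have hc : IsCompact (α '' Set.Icc A B ∪ β '' Set.Icc A B) :=
    (isCompact_Icc.image cα).union (isCompact_Icc.image cβ)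
  obtain ⟨ρ, hρ⟩ := hc.isBounded.subset_closedBall (0 : ℝ × ℝ)
  obtain ⟨K, hK⟩ := (hV.contDiffOn (s := Metric.closedBall (0 : ℝ × ℝ) ρ)).exists_lipschitzOnWith
    one_ne_zero (convex_closedBall _ _) (isCompact_closedBall _ _)
  exact ODE_solution_unique_of_mem_Ioo (v := fun _ => V) (s := fun _ => Metric.closedBall 0 ρ)
    (a := A) (b := B) (t₀ := t₀) (fun _ _ => hK) ⟨hA.2, hB.2⟩
    (fun s hs => ⟨hα s, hρ (Or.inl ⟨s, Set.Ioo_subset_Icc_self hs, rfl⟩)⟩)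
    (fun s hs => ⟨hβ s, hρ (Or.inr ⟨s, Set.Ioo_subset_Icc_self hs, rfl⟩)⟩) h ⟨hA.1, hB.1⟩

/-- A self-intersection would make the orbit periodic, and a periodic curve with limits at both ends
has equal limits. -/
theorem IsConnection.injective {V : ℝ × ℝ → ℝ × ℝ} (hV : ContDiff ℝ 1 V) {p q : ℝ × ℝ}
    (hpq : p ≠ q) {γ : ℝ → ℝ × ℝ} (h : IsConnection V p q γ) : Function.Injective γ := by
  intro s t hst
  by_contra hne
  obtain ⟨hd, hbot, htop⟩ := h
  have hper : Function.Periodic γ (t - s) := by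
    have := solution_eq_of_eq_at hV (α := fun u => γ (u + (t - s))) (β := γ) (t₀ := s)
      (fun u => by simpa using (hd (u + (t - s))).comp_add_const u (t - s)) hd (by simp [hst])
    intro u
    exact congrFun this u
  have key : ∀ T : ℝ, 0 < T → Function.Periodic γ T → False := by
    intro T hT hp
    have h1 : Tendsto (fun n : ℕ => (n : ℝ) * T) atTop atTop :=
      tendsto_natCast_atTop_atTop.atTop_mul_const hT
    have e1 : γ 0 = q := by
      refine tendsto_nhds_unique ?_ (htop.comp h1)
      refine tendsto_const_nhds.congr fun n => ?_
      simpa using (hp.nat_mul n 0).symm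
    have e2 : γ 0 = p := by
      refine tendsto_nhds_unique ?_ (hbot.comp (tendsto_neg_atTop_atBot.comp h1))
      refine tendsto_const_nhds.congr fun n => ?_
      have := hp.nat_mul n (-(n * T))
      simpa using this
    exact hpq (e2.symm.trans e1)
  rcases lt_or_gt_of_ne hne with hlt | hlt
  · exact key (t - s) (by linarith) hper
  · exact key (-(t - s)) (by linarith) hper.neg

theorem IsConnection.field_ne_zero {V : ℝ × ℝ → ℝ × ℝ} (hV : ContDiff ℝ 1 V) {p q : ℝ × ℝ}
    (hpq : p ≠ q) {γ : ℝ → ℝ × ℝ} (h : IsConnection V p q γ) (t : ℝ) : V (γ t) ≠ 0 := by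
  intro h0
  have : γ = fun _ => γ t := solution_eq_of_eq_at hV (t₀ := t) h.1
    (fun u => by rw [h0]; exact hasDerivAt_const _ _) rfl
  have h1 : γ 0 = γ 1 := by rw [this]
  exact zero_ne_one (h.injective hV hpq h1)

/-- A continuous function that is negative at `a` and nonnegative at `b` has a first zero. -/
theorem exists_first_zero {f : ℝ → ℝ} {a b : ℝ} (hf : Continuous f) (hab : a ≤ b) (ha : f a < 0)
    (hb : 0 ≤ f b) : ∃ c, a < c ∧ c ≤ b ∧ f c = 0 ∧ ∀ t, a ≤ t → t < c → f t < 0 := by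
  have hc : IsCompact (Set.Icc a b ∩ f ⁻¹' Set.Ici 0) :=
    isCompact_Icc.inter_right (isClosed_Ici.preimage hf)
  obtain ⟨c, ⟨⟨hac, hcb⟩, hfc⟩, hleast⟩ := hc.exists_isLeast ⟨b, ⟨hab, le_rfl⟩, hb⟩
  have hlt : ∀ t, a ≤ t → t < c → f t < 0 := by
    intro t h1 h2
    by_contra h3
    exact absurd (hleast ⟨⟨h1, h2.le.trans hcb⟩, not_lt.1 h3⟩) (not_le.2 h2)
  have hac' : a < c := by
    refine lt_of_le_of_ne hac fun h => ?_
    subst h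
    exact absurd hfc (not_le.2 ha)
  refine ⟨c, hac', hcb, le_antisymm ?_ hfc, hlt⟩
  have : Tendsto f (𝓝[<] c) (𝓝 (f c)) := hf.continuousAt.tendsto.mono_left nhdsWithin_le_nhds
  refine le_of_tendsto this ?_
  filter_upwards [Ioo_mem_nhdsLT hac'] with t ht
  exact (hlt t ht.1.le ht.2).le

/-! ### Behaviour of a connection near the saddles -/

section Orbit

variable {r : ℝ} {G : ℝ × ℝ → ℝ} {γ : ℝ → ℝ × ℝ}

theorem hasDerivAt_fst (h : ∀ t, HasDerivAt γ (dampedField r G (γ t)) t) (t : ℝ) :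
    HasDerivAt (fun t => (γ t).1) (γ t).2 t := by
  exact (ContinuousLinearMap.fst ℝ ℝ ℝ).hasFDerivAt.comp_hasDerivAt t (h t)

theorem hasDerivAt_snd (h : ∀ t, HasDerivAt γ (dampedField r G (γ t)) t) (t : ℝ) :
    HasDerivAt (fun t => (γ t).2)
      (-(γ t).1 + (γ t).1 ^ 3 / r ^ 2 + G (γ t) * (γ t).2) t := by
  exact (ContinuousLinearMap.snd ℝ ℝ ℝ).hasFDerivAt.comp_hasDerivAt t (h t)

theorem hasDerivAt_saddle_product (h : ∀ t, HasDerivAt γ (dampedField r G (γ t)) t) (t : ℝ) :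
    HasDerivAt (fun t => ((γ t).1 + r) * (γ t).2)
      ((γ t).2 * (γ t).2 +
        ((γ t).1 + r) * (-(γ t).1 + (γ t).1 ^ 3 / r ^ 2 + G (γ t) * (γ t).2)) t :=
  ((hasDerivAt_fst h t).add_const r).mul (hasDerivAt_snd h t)

/-- The force factors as `k (x + r)` with `k ≥ 3/4` for `x ≤ -r/2`, and the damping term costs at
most a quarter of `y² + (x + r)²`. Hence `(x + r) y` increases along orbits near the left saddle. -/
theorem saddle_product_deriv_lower (hr : 0 < r) {x y g : ℝ} (hx : x ≤ -r / 2) (hg : |g| ≤ 1 / 2) :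
    (y ^ 2 + (x + r) ^ 2) / 2 ≤ y * y + (x + r) * (-x + x ^ 3 / r ^ 2 + g * y) := by
  have e : -x + x ^ 3 / r ^ 2 = (x * (x - r) / r ^ 2) * (x + r) := by field_simp; ring
  have hh : 3 / 4 ≤ x * (x - r) / r ^ 2 := by
    rw [le_div_iff₀ (by positivity)]
    nlinarith
  rw [e]
  set k := x * (x - r) / r ^ 2
  have h1 : |(x + r) * (g * y)| ≤ 1 / 2 * |(x + r) * y| := by
    rw [show (x + r) * (g * y) = g * ((x + r) * y) by ring, abs_mul]
    gcongr
  have h2 : |(x + r) * y| ≤ ((x + r) ^ 2 + y ^ 2) / 2 := by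
    rw [abs_le]; constructor <;> nlinarith [sq_nonneg (x + r + y), sq_nonneg (x + r - y)]
  have h3 := neg_abs_le ((x + r) * (g * y))
  nlinarith [mul_nonneg (sub_nonneg.2 hh) (sq_nonneg (x + r))]

/-- A connection that starts from the left saddle leaves it into the upper right quadrant. -/
theorem IsConnection.eventually_start (hr : 0 < r) (hG : ContDiff ℝ 1 G)
    (h : IsConnection (dampedField r G) (-r, 0) (r, 0) γ) (hb : ∀ t, |G (γ t)| ≤ 1 / 2) :
    ∃ T, ∀ t ≤ T, -r < (γ t).1 ∧ 0 < (γ t).2 := by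
  obtain ⟨hd, hbot, htop⟩ := id h
  have hpq : ((-r, 0) : ℝ × ℝ) ≠ (r, 0) := by
    intro he
    have := congrArg Prod.fst he
    simp only at this
    linarith
  set P : ℝ → ℝ := fun t => ((γ t).1 + r) * (γ t).2 with hP
  have hPd := hasDerivAt_saddle_product hd
  have hPc : Continuous P := continuous_iff_continuousAt.2 fun t => (hPd t).continuousAt
  have hX : Tendsto (fun t => (γ t).1) atBot (𝓝 (-r)) := (continuous_fst.tendsto _).comp hbot
  have hY : Tendsto (fun t => (γ t).2) atBot (𝓝 0) := (continuous_snd.tendsto _).comp hbot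
  have hXc : Continuous fun t => (γ t).1 :=
    continuous_iff_continuousAt.2 fun t => (hasDerivAt_fst hd t).continuousAt
  obtain ⟨T, hT⟩ := eventually_atBot.1 (hX.eventually_le_const (show -r < -r / 2 by linarith))
  have hlow : ∀ t, (γ t).1 ≤ -r / 2 →
      ((γ t).2 ^ 2 + ((γ t).1 + r) ^ 2) / 2 ≤ deriv P t := by
    intro t ht
    rw [(hPd t).deriv]
    exact saddle_product_deriv_lower hr ht (hb t)
  -- `P` increases strictly from its limit `0` at `-∞`, so it is positive: the orbit leaves the
  -- saddle with `x + r` and `y` of the same sign.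
  have hmono : StrictMonoOn P (Set.Iic T) := by
    refine strictMonoOn_of_deriv_pos (convex_Iic T) hPc.continuousOn fun t ht => ?_
    rw [interior_Iic] at ht
    refine lt_of_lt_of_le ?_ (hlow t (hT t ht.le))
    by_contra hle
    have h1 : (γ t).2 = 0 := by nlinarith [sq_nonneg (γ t).2, sq_nonneg ((γ t).1 + r)]
    have h2 : (γ t).1 + r = 0 := by nlinarith [sq_nonneg (γ t).2, sq_nonneg ((γ t).1 + r)]
    refine h.field_ne_zero (contDiff_dampedField hG) hpq t ?_
    have h3 : (γ t).1 = -r := by linarith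
    ext <;> simp [dampedField, h1, h3]
    field_simp; ring
  have hP0 : Tendsto P atBot (𝓝 0) := by
    simpa using (hX.add_const r).mul hY
  have hPpos : ∀ t ≤ T, 0 < P t := by
    intro t ht
    have h1 : 0 ≤ P (t - 1) := by
      refine le_of_tendsto hP0 ?_
      filter_upwards [eventually_le_atBot (t - 1)] with s hs
      exact hmono.monotoneOn (show s ≤ T by linarith) (show t - 1 ≤ T by linarith) hs
    exact h1.trans_lt (hmono (show t - 1 ≤ T by linarith) ht (by linarith))
  -- Leaving to the left is impossible: the orbit must return to `x = -r` to reach `r`, but up to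
  -- the first return `P` does not decrease from a positive value, while it vanishes there.
  have hXT : 0 < (γ T).1 + r := by
    by_contra hle
    have hneg : (γ T).1 + r < 0 := by
      refine lt_of_le_of_ne (not_lt.1 hle) fun h0 => ?_
      have := hPpos T le_rfl
      simp [hP, h0] at this
    have hXtop : Tendsto (fun t => (γ t).1) atTop (𝓝 r) := (continuous_fst.tendsto _).comp htop
    obtain ⟨b, hb1, hb2⟩ := ((eventually_ge_atTop T).and
      (hXtop.eventually_const_le (show -r < r by linarith))).exists
    obtain ⟨c, hc1, -, hc3, hc4⟩ := exists_first_zero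
      (f := fun t => (γ t).1 + r) (hXc.add continuous_const) hb1 hneg (by linarith : 0 ≤ (γ b).1 + r)
    have : MonotoneOn P (Set.Icc T c) := by
      refine monotoneOn_of_deriv_nonneg (convex_Icc T c) hPc.continuousOn
        (fun t _ => (hPd t).differentiableAt.differentiableWithinAt) fun t ht => ?_
      rw [interior_Icc] at ht
      have := hc4 t ht.1.le ht.2
      exact le_trans (by positivity) (hlow t (by linarith))
    have h2 := this ⟨le_rfl, hc1.le⟩ ⟨hc1.le, le_rfl⟩ hc1.le
    have h3 := hPpos T le_rfl
    have h4 : P c = 0 := by simp only [hP]; rw [hc3, zero_mul]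
    linarith
  refine ⟨T, fun t ht => ?_⟩
  have h1 : 0 < (γ t).1 + r := by
    by_contra hle
    have : (0 : ℝ) ∈ (fun t => (γ t).1 + r) '' Set.Icc t T :=
      intermediate_value_Icc ht (hXc.add continuous_const).continuousOn ⟨not_lt.1 hle, hXT.le⟩
    obtain ⟨s, hs, hs0⟩ := this
    have := hPpos s hs.2
    simp only [hP] at this hs0
    rw [hs0, zero_mul] at this
    exact lt_irrefl _ this
  exact ⟨by linarith, pos_of_mul_pos_right (hPpos t ht) h1.le⟩

/-- The reflection `x ↦ -x` combined with time reversal keeps the form of the field and exchanges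
the two ends, so statements about the start transfer to the end. -/
theorem IsConnection.reverse (h : IsConnection (dampedField r G) (-r, 0) (r, 0) γ) :
    IsConnection (dampedField r fun p => -G (-p.1, p.2)) (-r, 0) (r, 0)
      fun t => (-(γ (-t)).1, (γ (-t)).2) := by
  obtain ⟨hd, hbot, htop⟩ := h
  refine ⟨fun t => ?_, ?_, ?_⟩
  · have h1 := ((hasDerivAt_fst hd (-t)).comp t (hasDerivAt_neg t)).neg
    have h2 := (hasDerivAt_snd hd (-t)).comp t (hasDerivAt_neg t)
    convert! h1.prodMk h2 using 1
    ext
    · simp [dampedField]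
    · simp [dampedField]
      ring
  · have h1 := htop.comp tendsto_neg_atBot_atTop
    have h2 : Continuous fun p : ℝ × ℝ => (-p.1, p.2) := by fun_prop
    exact (h2.tendsto (r, 0)).comp h1
  · have h1 := hbot.comp tendsto_neg_atTop_atBot
    have h2 : Continuous fun p : ℝ × ℝ => (-p.1, p.2) := by fun_prop
    have := (h2.tendsto (-r, 0)).comp h1
    simpa [Function.comp_def] using this

theorem IsConnection.eventually_end (hr : 0 < r) (hG : ContDiff ℝ 1 G)
    (h : IsConnection (dampedField r G) (-r, 0) (r, 0) γ) (hb : ∀ t, |G (γ t)| ≤ 1 / 2) :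
    ∃ T, ∀ t ≥ T, (γ t).1 < r ∧ 0 < (γ t).2 := by
  obtain ⟨T, hT⟩ := h.reverse.eventually_start hr (by fun_prop) (fun t => by simpa using hb (-t))
  refine ⟨-T, fun t ht => ?_⟩
  have := hT (-t) (by linarith)
  simp at this
  exact ⟨this.1, this.2⟩

end Orbit

/-- The image is again order-connected, and an order isomorphism between such sets is a
homeomorphism. Off the image the inverse is set to `0`. -/
theorem exists_continuous_inverse {x : ℝ → ℝ} {I : Set ℝ} (hI : I.OrdConnected)
    (hc : ContinuousOn x I) (hm : StrictMonoOn x I) :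
    ∃ τ : ℝ → ℝ, ContinuousOn τ (x '' I) ∧ ∀ t ∈ I, τ (x t) = t := by
  have hJ : (x '' I).OrdConnected := (hI.isPreconnected.image x hc).ordConnected
  set e := hm.orderIso
  refine ⟨Function.extend Subtype.val (fun z => ((e.symm z : I) : ℝ)) 0, ?_, fun t ht => ?_⟩
  · rw [continuousOn_iff_continuous_domRestrict]
    have : Continuous fun z => ((e.symm z : I) : ℝ) :=
      continuous_subtype_val.comp e.symm.continuous
    convert! this using 1
    ext z
    exact Subtype.val_injective.extend_apply _ _ z
  · have h1 : x t = ((e ⟨t, ht⟩ : x '' I) : ℝ) := rfl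
    rw [h1, Subtype.val_injective.extend_apply, e.symm_apply_apply]

/-! ### Connections stay in the upper half plane -/

section Orbit

variable {r : ℝ} {G : ℝ × ℝ → ℝ} {γ : ℝ → ℝ × ℝ}

theorem deriv_nonpos_of_pos_left {f : ℝ → ℝ} {f' a : ℝ} (hf : HasDerivAt f f' a) (ha : f a = 0)
    (h : ∀ t < a, 0 < f t) : f' ≤ 0 := by
  have := (hasDerivWithinAt_iff_tendsto_slope' (s := Set.Iio a) (by simp)).1
    (hf.hasDerivWithinAt (s := Set.Iio a))
  refine le_of_tendsto this ?_
  filter_upwards [self_mem_nhdsWithin] with t ht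
  rw [slope_def_field, ha, sub_zero]
  exact div_nonpos_of_nonneg_of_nonpos (h t ht).le (sub_nonpos.2 (le_of_lt ht))

theorem deriv_nonneg_of_pos_right {f : ℝ → ℝ} {f' a : ℝ} (hf : HasDerivAt f f' a) (ha : f a = 0)
    (h : ∀ t > a, 0 < f t) : 0 ≤ f' := by
  have := (hasDerivWithinAt_iff_tendsto_slope' (s := Set.Ioi a) (by simp)).1
    (hf.hasDerivWithinAt (s := Set.Ioi a))
  refine ge_of_tendsto this ?_
  filter_upwards [self_mem_nhdsWithin] with t ht
  rw [slope_def_field, ha, sub_zero]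
  exact div_nonneg (h t ht).le (sub_nonneg.2 (le_of_lt ht))

theorem saddle_ne (hr : 0 < r) : ((-r, 0) : ℝ × ℝ) ≠ (r, 0) := by
  intro he
  have := congrArg Prod.fst he
  simp only at this
  linarith

/-- A connection from the left to the right saddle stays in the upper half plane. -/
theorem IsConnection.snd_pos (hr : 0 < r) (hG : ContDiff ℝ 1 G)
    (h : IsConnection (dampedField r G) (-r, 0) (r, 0) γ) (hb : ∀ t, |G (γ t)| ≤ 1 / 2) (t : ℝ) :
    0 < (γ t).2 := by
  by_contra hle
  obtain ⟨T₁, hT₁⟩ := h.eventually_start hr hG hb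
  obtain ⟨T₂, hT₂⟩ := h.eventually_end hr hG hb
  have hV := contDiff_dampedField (r := r) hG
  have hinj := h.injective hV (saddle_ne hr)
  have hne := h.field_ne_zero hV (saddle_ne hr)
  obtain ⟨hd, hbot, htop⟩ := id h
  have hxd := hasDerivAt_fst hd
  have hyd := hasDerivAt_snd hd
  have hx : Continuous fun t => (γ t).1 :=
    continuous_iff_continuousAt.2 fun t => (hxd t).continuousAt
  have hy : Continuous fun t => (γ t).2 :=
    continuous_iff_continuousAt.2 fun t => (hyd t).continuousAt
  have h1 : T₁ ≤ t := by
    by_contra hlt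
    exact hle (hT₁ t (not_le.1 hlt).le).2
  have h2 : t ≤ T₂ := by
    by_contra hlt
    exact hle (hT₂ t (not_le.1 hlt).le).2
  -- If `y` is nonpositive somewhere, let `c` be its first zero and `e` its last, found as a first
  -- zero in reversed time. On `t ≤ c` and on `t ≥ e` the orbit is a graph over `x`.
  obtain ⟨c, hc1, hc2, hc3, hc4⟩ := exists_first_zero (f := fun t => -(γ t).2) hy.neg h1
    (by simpa using (hT₁ T₁ le_rfl).2) (by simpa using hle)
  obtain ⟨d, hd1, hd2, hd3, hd4⟩ := exists_first_zero (f := fun t => -(γ (-t)).2)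
    (hy.comp continuous_neg).neg (neg_le_neg h2) (by simpa using (hT₂ T₂ le_rfl).2)
    (by simpa using hle)
  obtain ⟨e, rfl⟩ : ∃ e, d = -e := ⟨-d, (neg_neg d).symm⟩
  simp only [neg_eq_zero, neg_neg] at hc3 hd3
  have hcpos : ∀ s < c, 0 < (γ s).2 := by
    intro s hs
    rcases le_total s T₁ with hs1 | hs1
    · exact (hT₁ s hs1).2
    · simpa using hc4 s hs1 hs
  have hepos : ∀ s > e, 0 < (γ s).2 := by
    intro s hs
    rcases le_total T₂ s with hs1 | hs1
    · exact (hT₂ s hs1).2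
    · simpa using hd4 (-s) (by linarith) (by linarith)
  have hmc : StrictMonoOn (fun t => (γ t).1) (Set.Iic c) :=
    strictMonoOn_of_deriv_pos (convex_Iic c) hx.continuousOn fun s hs => by
      rw [interior_Iic] at hs
      rw [(hxd s).deriv]
      exact hcpos s hs
  have hme : StrictMonoOn (fun t => (γ t).1) (Set.Ici e) :=
    strictMonoOn_of_deriv_pos (convex_Ici e) hx.continuousOn fun s hs => by
      rw [interior_Ici] at hs
      rw [(hxd s).deriv]
      exact hepos s hs
  have hce : c ≤ e := by linarith
  have hxc : -r < (γ c).1 := (hT₁ T₁ le_rfl).1.trans (hmc (Set.mem_Iic.2 hc1.le) Set.self_mem_Iic hc1)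
  have hxe : (γ e).1 < r := by
    have : e < T₂ := by linarith
    exact (hme Set.self_mem_Ici (Set.mem_Ici.2 this.le) this).trans (hT₂ T₂ le_rfl).1
  have hg : ∀ s, (γ s).2 = 0 → -(γ s).1 + (γ s).1 ^ 3 / r ^ 2 ≠ 0 := by
    intro s hs h0
    refine hne s ?_
    ext <;> simp [dampedField, hs, h0]
  have hgf : ∀ x : ℝ, (-x + x ^ 3 / r ^ 2) * r ^ 2 = x * (x - r) * (x + r) := by
    intro x; field_simp; ring
  -- At `c` the height falls to zero at a non-equilibrium, so the force is strictly negative; this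
  -- places `c` over `(0, r)`. At `e` the signs are opposite, so the two branches overlap over
  -- `[x(e), x(c)]`.
  have hgc : 0 < (γ c).1 ∧ (γ c).1 < r := by
    have h3 := deriv_nonpos_of_pos_left (hyd c) hc3 hcpos
    rw [hc3, mul_zero, add_zero] at h3
    have h4 := lt_of_le_of_ne h3 (hg c hc3)
    have h5 := mul_neg_of_neg_of_pos h4 (by positivity : 0 < r ^ 2)
    rw [hgf] at h5
    have h6 : (γ c).1 * ((γ c).1 - r) < 0 := by
      by_contra h7
      exact absurd h5 (not_lt.2 (mul_nonneg (not_lt.1 h7) (by linarith)))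
    constructor <;> nlinarith
  have hge : -r < (γ e).1 ∧ (γ e).1 < 0 := by
    have h3 := deriv_nonneg_of_pos_right (hyd e) hd3 hepos
    rw [hd3, mul_zero, add_zero] at h3
    have h4 := lt_of_le_of_ne h3 (hg e hd3).symm
    have h5 := mul_pos h4 (by positivity : 0 < r ^ 2)
    rw [hgf] at h5
    have h6 : (γ e).1 * ((γ e).1 + r) < 0 := by nlinarith
    constructor <;> nlinarith
  obtain ⟨σ, hσc, hσ⟩ := exists_continuous_inverse Set.ordConnected_Iic hx.continuousOn hmc
  obtain ⟨τ, hτc, hτ⟩ := exists_continuous_inverse Set.ordConnected_Ici hx.continuousOn hme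
  have hX : Tendsto (fun t => (γ t).1) atBot (𝓝 (-r)) := (continuous_fst.tendsto _).comp hbot
  have hX' : Tendsto (fun t => (γ t).1) atTop (𝓝 r) := (continuous_fst.tendsto _).comp htop
  have hsub1 : Set.Icc (γ e).1 (γ c).1 ⊆ (fun t => (γ t).1) '' Set.Iic c := by
    obtain ⟨s, hs1, hs2⟩ := ((eventually_le_atBot c).and
      (hX.eventually_le_const hge.1)).exists
    intro z hz
    obtain ⟨u, hu, rfl⟩ := intermediate_value_Icc hs1 hx.continuousOn ⟨hs2.trans hz.1, hz.2⟩
    exact ⟨u, hu.2, rfl⟩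
  have hsub2 : Set.Icc (γ e).1 (γ c).1 ⊆ (fun t => (γ t).1) '' Set.Ici e := by
    obtain ⟨s, hs1, hs2⟩ := ((eventually_ge_atTop e).and
      (hX'.eventually_const_le hgc.2)).exists
    intro z hz
    obtain ⟨u, hu, rfl⟩ := intermediate_value_Icc hs1 hx.continuousOn ⟨hz.1, hz.2.trans hs2⟩
    exact ⟨u, hu.1, rfl⟩
  have hle' : (γ e).1 ≤ (γ c).1 := by linarith
  have hφ : ContinuousOn (fun z => (γ (τ z)).2 - (γ (σ z)).2) (Set.Icc (γ e).1 (γ c).1) :=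
    (hy.comp_continuousOn (hτc.mono hsub2)).sub (hy.comp_continuousOn (hσc.mono hsub1))
  have hnn : ∀ s ≤ c, 0 ≤ (γ s).2 := by
    intro s hs
    rcases hs.eq_or_lt with rfl | hs
    · exact hc3.ge
    · exact (hcpos s hs).le
  have hnn' : ∀ s ≥ e, 0 ≤ (γ s).2 := by
    intro s hs
    rcases hs.eq_or_lt with rfl | hs
    · exact hd3.ge
    · exact (hepos s hs).le
  -- Each branch is zero at one end of the overlap while the other is nonnegative there, so the two
  -- graphs meet. Injectivity then forces equal times, hence `c = e`, against the opposite signs of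
  -- `x(c)` and `x(e)`.
  have hmem : (0 : ℝ) ∈ Set.Icc ((γ (τ (γ e).1)).2 - (γ (σ (γ e).1)).2)
      ((γ (τ (γ c).1)).2 - (γ (σ (γ c).1)).2) := by
    constructor
    · obtain ⟨s, hs, hs'⟩ := hsub1 ⟨le_rfl, hle'⟩
      have := hσ s hs
      simp only at hs' this
      rw [hτ e Set.self_mem_Ici, hd3, ← hs', this]
      linarith [hnn s hs]
    · obtain ⟨s, hs, hs'⟩ := hsub2 ⟨hle', le_rfl⟩
      have := hτ s hs
      simp only at hs' this
      rw [hσ c Set.self_mem_Iic, hc3, ← hs', this]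
      linarith [hnn' s hs]
  obtain ⟨z, hz, hz0⟩ := intermediate_value_Icc hle' hφ hmem
  obtain ⟨s, hs, hs'⟩ := hsub1 hz
  obtain ⟨u, hu, hu'⟩ := hsub2 hz
  have e1 := hσ s hs
  have e2 := hτ u hu
  simp only at hs' hu' hz0 e1 e2
  rw [← hs'] at hz0
  nth_rewrite 1 [hs', ← hu'] at hz0
  rw [e1, e2] at hz0
  have hus : u = s := hinj (Prod.ext (hu'.trans hs'.symm) (by linarith))
  have hs1 : s ≤ c := hs
  have hu1 : e ≤ u := hu
  have e3 : s = c := by linarith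
  have e4 : u = e := by linarith
  rw [← e3, hs'] at hgc
  rw [← e4, hu'] at hge
  linarith [hgc.1, hge.2]

end Orbit

/-! ### Graphs and the energy balance -/

/-- The height `κ (r² - x²)` of the unperturbed arc. -/
def arcProfile (κ r x : ℝ) : ℝ := κ * (r ^ 2 - x ^ 2)

/-- The normalisation `2 κ² r² = 1` is what makes the parabola an orbit of the undamped field. -/
theorem hasDerivAt_arcProfile_sq {κ r : ℝ} (hr : 0 < r) (hκ : 2 * κ ^ 2 * r ^ 2 = 1) (x : ℝ) :
    HasDerivAt (fun x => arcProfile κ r x ^ 2) (2 * (-x + x ^ 3 / r ^ 2)) x := by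
  have h : HasDerivAt (fun x => arcProfile κ r x ^ 2)
      (2 * (κ * (r ^ 2 - x ^ 2)) * (κ * (-(2 * x)))) x := by
    unfold arcProfile
    have := (((hasDerivAt_pow 2 x).const_sub (r ^ 2)).const_mul κ).pow 2
    convert! this using 1
    push_cast
    ring
  convert! h using 1
  have : 2 * κ ^ 2 = 1 / r ^ 2 := by field_simp; linarith
  calc 2 * (-x + x ^ 3 / r ^ 2) = (1 / r ^ 2) * (2 * (x ^ 2 - r ^ 2) * x) := by
        field_simp; ring
    _ = _ := by rw [← this]; ring

section Orbit

variable {r : ℝ} {G : ℝ × ℝ → ℝ} {γ : ℝ → ℝ × ℝ}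

/-- A connection from the left to the right saddle is the graph of a function of the abscissa. -/
theorem IsConnection.exists_graph (hr : 0 < r) (hG : ContDiff ℝ 1 G)
    (h : IsConnection (dampedField r G) (-r, 0) (r, 0) γ) (hb : ∀ t, |G (γ t)| ≤ 1 / 2) :
    ∃ U : ℝ → ℝ, ContinuousOn U (Set.Icc (-r) r) ∧ U (-r) = 0 ∧ U r = 0 ∧
      (∀ x ∈ Set.Ioo (-r) r, 0 < U x ∧ (∃ t, γ t = (x, U x)) ∧
        HasDerivAt (fun x => U x ^ 2) (2 * (-x + x ^ 3 / r ^ 2) + 2 * (G (x, U x) * U x)) x) := by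
  have hpos := h.snd_pos hr hG hb
  obtain ⟨hd, hbot, htop⟩ := id h
  have hxd := hasDerivAt_fst hd
  have hyd := hasDerivAt_snd hd
  have hx : Continuous fun t => (γ t).1 :=
    continuous_iff_continuousAt.2 fun t => (hxd t).continuousAt
  have hm : StrictMono fun t => (γ t).1 :=
    strictMono_of_deriv_pos fun t => by rw [(hxd t).deriv]; exact hpos t
  have hX : Tendsto (fun t => (γ t).1) atBot (𝓝 (-r)) := (continuous_fst.tendsto _).comp hbot
  have hX' : Tendsto (fun t => (γ t).1) atTop (𝓝 r) := (continuous_fst.tendsto _).comp htop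
  have hY : Tendsto (fun t => (γ t).2) atBot (𝓝 0) := (continuous_snd.tendsto _).comp hbot
  have hY' : Tendsto (fun t => (γ t).2) atTop (𝓝 0) := (continuous_snd.tendsto _).comp htop
  have hmem : ∀ t, (γ t).1 ∈ Set.Ioo (-r) r := fun t =>
    ⟨(hm.monotone.le_of_tendsto hX (t - 1)).trans_lt (hm (by linarith)),
      (hm (by linarith : t < t + 1)).trans_le (hm.monotone.ge_of_tendsto hX' (t + 1))⟩
  have hsurj : ∀ z ∈ Set.Ioo (-r) r, ∃ t, (γ t).1 = z := by
    intro z hz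
    obtain ⟨s, hs⟩ := (hX.eventually_le_const hz.1).exists
    obtain ⟨u, hu⟩ := (hX'.eventually_const_le hz.2).exists
    exact mem_range_of_exists_le_of_exists_ge hx ⟨s, hs⟩ ⟨u, hu⟩
  obtain ⟨τ, hτc, hτ⟩ := exists_continuous_inverse Set.ordConnected_univ hx.continuousOn
    (hm.strictMonoOn _)
  have himg : (fun t => (γ t).1) '' Set.univ = Set.Ioo (-r) r := by
    ext z
    constructor
    · rintro ⟨t, -, rfl⟩
      exact hmem t
    · intro hz
      obtain ⟨t, ht⟩ := hsurj z hz
      exact ⟨t, trivial, ht⟩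
  rw [himg] at hτc
  -- The extension by zero is continuous at `±r` because the height of the orbit tends to zero at
  -- both time ends.
  set U : ℝ → ℝ := (Set.Ioo (-r) r).indicator fun z => (γ (τ z)).2 with hU
  have hUin : ∀ z ∈ Set.Ioo (-r) r, U z = (γ (τ z)).2 := fun z hz => Set.indicator_of_mem hz _
  have hUγ : ∀ t, U (γ t).1 = (γ t).2 := fun t => by rw [hUin _ (hmem t), hτ t trivial]
  have hU0 : ∀ z, z ∉ Set.Ioo (-r) r → U z = 0 := fun z hz => Set.indicator_of_notMem hz _
  have hder : ∀ t, HasDerivAt U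
      ((-(γ t).1 + (γ t).1 ^ 3 / r ^ 2 + G (γ t) * (γ t).2) * (γ t).2⁻¹) (γ t).1 := by
    intro t
    have hnhds : Set.Ioo (-r) r ∈ 𝓝 (γ t).1 := isOpen_Ioo.mem_nhds (hmem t)
    have h1 : HasDerivAt τ (γ t).2⁻¹ (γ t).1 := by
      refine HasDerivAt.of_local_left_inverse (f := fun t => (γ t).1) (hτc.continuousAt hnhds) ?_
        (hpos t).ne' ?_
      · rw [hτ t trivial]
        exact hxd t
      · filter_upwards [hnhds] with z hz
        obtain ⟨s, rfl⟩ := hsurj z hz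
        rw [hτ s trivial]
    have h2 : HasDerivAt (fun t => (γ t).2)
        (-(γ t).1 + (γ t).1 ^ 3 / r ^ 2 + G (γ t) * (γ t).2) (τ (γ t).1) := by
      rw [hτ t trivial]
      exact hyd t
    refine (h2.comp (γ t).1 h1).congr_of_eventuallyEq ?_
    filter_upwards [hnhds] with z hz
    exact hUin z hz
  refine ⟨U, ?_, hU0 _ (by simp), hU0 _ (by simp), ?_⟩
  · intro x hx'
    rcases hx'.1.eq_or_lt with rfl | h1
    · rw [Metric.continuousWithinAt_iff']
      intro η hη
      obtain ⟨T, hT⟩ := eventually_atBot.1 (Metric.tendsto_nhds.1 hY η hη)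
      filter_upwards [mem_nhdsWithin_of_mem_nhds (Iio_mem_nhds (hmem T).1)] with z hz
      rw [hU0 (-r) (by simp)]
      by_cases hz' : z ∈ Set.Ioo (-r) r
      · obtain ⟨s, rfl⟩ := hsurj z hz'
        rw [hUγ]
        exact hT s (hm.lt_iff_lt.1 hz).le
      · rw [hU0 z hz', dist_self]
        exact hη
    rcases hx'.2.eq_or_lt with rfl | h2
    · rw [Metric.continuousWithinAt_iff']
      intro η hη
      obtain ⟨T, hT⟩ := eventually_atTop.1 (Metric.tendsto_nhds.1 hY' η hη)
      filter_upwards [mem_nhdsWithin_of_mem_nhds (Ioi_mem_nhds (hmem T).2)] with z hz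
      rw [hU0 x (by simp)]
      by_cases hz' : z ∈ Set.Ioo (-x) x
      · obtain ⟨s, rfl⟩ := hsurj z hz'
        rw [hUγ]
        exact hT s (hm.lt_iff_lt.1 hz).le
      · rw [hU0 z hz', dist_self]
        exact hη
    obtain ⟨t, rfl⟩ := hsurj x ⟨h1, h2⟩
    exact (hder t).continuousAt.continuousWithinAt
  · intro x hx'
    obtain ⟨t, rfl⟩ := hsurj x hx'
    rw [hUγ]
    refine ⟨hpos t, ⟨t, rfl⟩, ?_⟩
    have h3 := (hder t).pow 2
    rw [hUγ] at h3
    convert! h3 using 1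
    have := (hpos t).ne'
    push_cast
    field_simp

/-- The energy balance along the graph of a connection. -/
theorem graph_sq_eq {κ : ℝ} (hr : 0 < r) (hκ : 2 * κ ^ 2 * r ^ 2 = 1) {U : ℝ → ℝ}
    (hG : Continuous G) (hU : ContinuousOn U (Set.Icc (-r) r)) (hl : U (-r) = 0)
    (hder : ∀ x ∈ Set.Ioo (-r) r,
      HasDerivAt (fun x => U x ^ 2) (2 * (-x + x ^ 3 / r ^ 2) + 2 * (G (x, U x) * U x)) x)
    {x : ℝ} (hx : x ∈ Set.Icc (-r) r) :
    U x ^ 2 = arcProfile κ r x ^ 2 + 2 * ∫ ξ in (-r)..x, G (ξ, U ξ) * U ξ := by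
  have hc : ContinuousOn (fun ξ => 2 * (G (ξ, U ξ) * U ξ)) (Set.Icc (-r) r) :=
    continuousOn_const.mul ((hG.comp_continuousOn (continuousOn_id.prodMk hU)).mul hU)
  have hsub : Set.Icc (-r) x ⊆ Set.Icc (-r) r := Set.Icc_subset_Icc_right hx.2
  have h1 := intervalIntegral.integral_eq_sub_of_hasDerivAt_of_le hx.1
    (f := fun x => U x ^ 2 - arcProfile κ r x ^ 2) (f' := fun ξ => 2 * (G (ξ, U ξ) * U ξ))
    (((hU.pow 2).sub (by unfold arcProfile; fun_prop)).mono hsub)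
    (fun z hz => by
      have := (hder z ⟨hz.1, hz.2.trans_le hx.2⟩).sub (hasDerivAt_arcProfile_sq hr hκ z)
      convert! this using 1
      ring)
    ((hc.mono hsub).intervalIntegrable_of_Icc hx.1)
  rw [intervalIntegral.integral_const_mul] at h1
  have h2 : arcProfile κ r (-r) = 0 := by simp [arcProfile]
  rw [h1, hl, h2]
  ring

end Orbit

/-! ### A priori comparison of a graph with the unperturbed arc -/

/-- The energy error must be `O((x + r)²)` to be comparable with `arcProfile²`, which requires `U =
O(x + r)`. At a maximum point `m` of `U` on `[-r, z]` the balance reads `U(m)² ≤ (2κr(m + r))² + 2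
(m + r) U(m)`, and this gives the linear bound. On `x ≤ 0` the arc is at least `κ r (x + r)`. -/
theorem graph_bound_left {κ r F : ℝ} (hr : 0 < r) (hκ0 : 0 < κ) (hF : F ≤ 1) {U h : ℝ → ℝ}
    (hU : ContinuousOn U (Set.Icc (-r) r)) (hU0 : ∀ x ∈ Set.Icc (-r) r, 0 ≤ U x)
    (hh : ∀ x ∈ Set.Ioo (-r) r, |h x| ≤ F)
    (he : ∀ x ∈ Set.Icc (-r) r,
      U x ^ 2 = arcProfile κ r x ^ 2 + 2 * ∫ ξ in (-r)..x, h ξ * U ξ)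
    {x : ℝ} (hx : -r ≤ x) (hx0 : x ≤ 0) :
    |U x ^ 2 - arcProfile κ r x ^ 2| ≤
      F * ((4 + 4 * κ * r) / (κ * r) ^ 2) * arcProfile κ r x ^ 2 := by
  have hF0 : 0 ≤ F := (abs_nonneg _).trans (hh 0 ⟨by linarith, hr⟩)
  have hint : ∀ z B, -r ≤ z → z ≤ 0 → (∀ ξ, -r ≤ ξ → ξ ≤ z → U ξ ≤ B) →
      |∫ ξ in (-r)..z, h ξ * U ξ| ≤ F * B * (z + r) := by
    intro z B hz hz0 hB
    have := intervalIntegral.norm_integral_le_of_norm_le_const (a := -r) (b := z) (C := F * B)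
      (f := fun ξ => h ξ * U ξ) (fun ξ hξ => by
        rw [Set.uIoc_of_le hz] at hξ
        rw [Real.norm_eq_abs, abs_mul, abs_of_nonneg (hU0 ξ ⟨hξ.1.le, by linarith [hξ.2]⟩)]
        have h1 := hh ξ ⟨hξ.1, by linarith [hξ.2]⟩
        have h2 := hB ξ hξ.1.le hξ.2
        exact mul_le_mul h1 h2 (hU0 ξ ⟨hξ.1.le, by linarith [hξ.2]⟩) hF0)
    rwa [Real.norm_eq_abs, sub_neg_eq_add, abs_of_nonneg (by linarith : 0 ≤ z + r)] at this
  have key : ∀ z, -r ≤ z → z ≤ 0 → U z ≤ (2 + 2 * κ * r) * (z + r) := by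
    intro z hz hz0
    obtain ⟨m, hm, hmax⟩ := isCompact_Icc.exists_isMaxOn (Set.nonempty_Icc.2 hz)
      (hU.mono (Set.Icc_subset_Icc_right (by linarith : z ≤ r)))
    have hmU := hU0 m ⟨hm.1, by linarith [hm.2]⟩
    have h1 := hint m (U m) hm.1 (hm.2.trans hz0) fun ξ h2 h3 => hmax ⟨h2, h3.trans hm.2⟩
    have h2 := he m ⟨hm.1, by linarith [hm.2]⟩
    have h3 : arcProfile κ r m ≤ 2 * κ * r * (m + r) := by
      unfold arcProfile
      have : 0 ≤ κ * (m + r) ^ 2 := by positivity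
      nlinarith
    have h4 : 0 ≤ arcProfile κ r m := by
      unfold arcProfile
      have : 0 ≤ r ^ 2 - m ^ 2 := by nlinarith [hm.1, hm.2]
      positivity
    have hX : 0 ≤ m + r := by linarith [hm.1]
    have h5 : U m ^ 2 ≤ (2 * κ * r * (m + r)) ^ 2 + 2 * (m + r) * U m := by
      have h6 : arcProfile κ r m ^ 2 ≤ (2 * κ * r * (m + r)) ^ 2 := by gcongr
      have h7 := (abs_le.1 h1).2
      have h8 : F * U m * (m + r) ≤ 1 * U m * (m + r) := by gcongr
      linarith
    have h6 : U m ≤ (2 + 2 * κ * r) * (m + r) := by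
      by_contra hlt
      rw [not_le] at hlt
      have h7 : 0 ≤ κ * r * (m + r) := by positivity
      nlinarith
    calc U z ≤ U m := hmax ⟨hz, le_rfl⟩
      _ ≤ _ := h6
      _ ≤ _ := by gcongr; exact hm.2
  have h1 := hint x ((2 + 2 * κ * r) * (x + r)) hx hx0 fun ξ h2 h3 =>
    (key ξ h2 (h3.trans hx0)).trans (by gcongr)
  rw [he x ⟨hx, by linarith⟩, add_sub_cancel_left, abs_mul, abs_two]
  have h2 : κ * r * (x + r) ≤ arcProfile κ r x := by
    unfold arcProfile
    have : 0 ≤ κ * ((x + r) * (-x)) := by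
      have : 0 ≤ (x + r) * (-x) := mul_nonneg (by linarith) (by linarith)
      positivity
    nlinarith
  have h3 : (κ * r) ^ 2 * (x + r) ^ 2 ≤ arcProfile κ r x ^ 2 := by
    rw [← mul_pow]
    have : 0 ≤ κ * r * (x + r) := mul_nonneg (by positivity) (by linarith)
    gcongr
  have h4 : (x + r) ^ 2 ≤ arcProfile κ r x ^ 2 / (κ * r) ^ 2 := by
    rw [le_div_iff₀ (by positivity)]
    linarith
  calc 2 * |∫ ξ in (-r)..x, h ξ * U ξ|
      ≤ F * (4 + 4 * κ * r) * (x + r) ^ 2 := by linarith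
    _ ≤ F * (4 + 4 * κ * r) * (arcProfile κ r x ^ 2 / (κ * r) ^ 2) := by gcongr
    _ = _ := by ring

/-- Since the total gain vanishes, the gain up to `x` is minus the gain from `x` to `r`. The right
half is therefore the left half of the reflected graph, with `h` replaced by `-h(-·)`. -/
theorem graph_bound {κ r F : ℝ} (hr : 0 < r) (hκ0 : 0 < κ) (hF : F ≤ 1) {U h : ℝ → ℝ}
    (hU : ContinuousOn U (Set.Icc (-r) r)) (hh' : ContinuousOn h (Set.Icc (-r) r))
    (hU0 : ∀ x ∈ Set.Icc (-r) r, 0 ≤ U x)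
    (hh : ∀ x ∈ Set.Ioo (-r) r, |h x| ≤ F)
    (he : ∀ x ∈ Set.Icc (-r) r,
      U x ^ 2 = arcProfile κ r x ^ 2 + 2 * ∫ ξ in (-r)..x, h ξ * U ξ)
    (htot : ∫ ξ in (-r)..r, h ξ * U ξ = 0) {x : ℝ} (hx : x ∈ Set.Icc (-r) r) :
    |U x ^ 2 - arcProfile κ r x ^ 2| ≤
      F * ((4 + 4 * κ * r) / (κ * r) ^ 2) * arcProfile κ r x ^ 2 := by
  rcases le_total x 0 with h0 | h0
  · exact graph_bound_left hr hκ0 hF hU hU0 hh he hx.1 h0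
  have hneg : ∀ z ∈ Set.Icc (-r) r, -z ∈ Set.Icc (-r) r := fun z hz =>
    ⟨by linarith [hz.2], by linarith [hz.1]⟩
  have hA : ∀ z, arcProfile κ r (-z) = arcProfile κ r z := fun z => by simp [arcProfile]
  have hc : ContinuousOn (fun ξ => h ξ * U ξ) (Set.Icc (-r) r) := hh'.mul hU
  have := graph_bound_left (x := -x) hr hκ0 hF (U := fun z => U (-z)) (h := fun z => -h (-z))
    (hU.comp continuousOn_neg hneg) (fun z hz => hU0 _ (hneg z hz))
    (fun z hz => by
      rw [abs_neg]
      exact hh _ ⟨by linarith [hz.2], by linarith [hz.1]⟩)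
    (fun z hz => by
      have hi1 : IntervalIntegrable (fun ξ => h ξ * U ξ) MeasureTheory.volume (-r) (-z) :=
        (hc.mono (Set.Icc_subset_Icc_right (hneg z hz).2)).intervalIntegrable_of_Icc (hneg z hz).1
      have hi2 : IntervalIntegrable (fun ξ => h ξ * U ξ) MeasureTheory.volume (-z) r :=
        (hc.mono (Set.Icc_subset_Icc_left (hneg z hz).1)).intervalIntegrable_of_Icc (hneg z hz).2
      have h1 := intervalIntegral.integral_add_adjacent_intervals hi1 hi2
      have h2 : ∫ ξ in (-r)..z, -h (-ξ) * U (-ξ) = -∫ ξ in (-z)..r, h ξ * U ξ := by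
        have := intervalIntegral.integral_comp_neg (a := -r) (b := z) fun ξ => h ξ * U ξ
        rw [neg_neg] at this
        rw [← this, ← intervalIntegral.integral_neg]
        simp only [neg_mul]
      rw [h2, he _ (hneg z hz), hA]
      linarith)
    (by linarith [hx.2]) (by linarith)
  simpa only [neg_neg, hA] using this

/-! ### Contractions on the space of profiles -/

/-- The functions that are continuous on `(-r, r)` with values in `[1/2, 2]`. -/
def IsProfile (r : ℝ) (S : ℝ → ℝ) : Prop :=
  ContinuousOn S (Set.Ioo (-r) r) ∧ ∀ x ∈ Set.Ioo (-r) r, S x ∈ Set.Icc (1 / 2 : ℝ) 2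

/-- Banach iteration from the constant `1` in the supremum distance over the open interval. The
limit is uniform, so continuity and the bounds survive; two profiles differ by less than `2`, which
starts the geometric estimate. -/
theorem exists_fixed_profile {r : ℝ} {T : (ℝ → ℝ) → ℝ → ℝ}
    (hT : ∀ S, IsProfile r S → IsProfile r (T S))
    (hc : ∀ S S' δ, IsProfile r S → IsProfile r S' → (∀ x ∈ Set.Ioo (-r) r, |S x - S' x| ≤ δ) →
      ∀ x ∈ Set.Ioo (-r) r, |T S x - T S' x| ≤ δ / 4) :
    ∃ S, IsProfile r S ∧ ∀ x ∈ Set.Ioo (-r) r, T S x = S x := by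
  set s : ℕ → ℝ → ℝ := fun n => T^[n] fun _ => 1 with hs
  have hs1 : ∀ n, s (n + 1) = T (s n) := fun n => Function.iterate_succ_apply' _ _ _
  have hp : ∀ n, IsProfile r (s n) := by
    intro n
    induction n with
    | zero => exact ⟨continuousOn_const, fun x _ => by simp [hs]; norm_num⟩
    | succ n ih => rw [hs1]; exact hT _ ih
  have hd : ∀ n, ∀ x ∈ Set.Ioo (-r) r, |s n x - s (n + 1) x| ≤ 2 * (1 / 4 : ℝ) ^ n := by
    intro n
    induction n with
    | zero =>
      intro x hx
      have h1 := (hp 0).2 x hx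
      have h2 := (hp 1).2 x hx
      rw [abs_le]
      constructor <;> norm_num <;> linarith [h1.1, h1.2, h2.1, h2.2]
    | succ n ih =>
      intro x hx
      rw [hs1 n, hs1 (n + 1)]
      refine (hc _ _ _ (hp n) (hp (n + 1)) ih x hx).trans (le_of_eq ?_)
      rw [pow_succ]
      ring
  have hlim : ∀ x, ∃ L, x ∈ Set.Ioo (-r) r → Tendsto (fun n => s n x) atTop (𝓝 L) := by
    intro x
    by_cases hx : x ∈ Set.Ioo (-r) r
    · obtain ⟨L, hL⟩ := cauchySeq_tendsto_of_complete
        (cauchySeq_of_le_geometric (f := fun n => s n x) (1 / 4 : ℝ) 2 (by norm_num) fun n => hd n x hx)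
      exact ⟨L, fun _ => hL⟩
    · exact ⟨0, fun h => absurd h hx⟩
  choose S hS using hlim
  have hdist : ∀ n, ∀ x ∈ Set.Ioo (-r) r, |s n x - S x| ≤ 2 * (1 / 4 : ℝ) ^ n / (1 - 1 / 4) :=
    fun n x hx => dist_le_of_le_geometric_of_tendsto (f := fun n => s n x) (1 / 4 : ℝ) 2 (by norm_num)
      (fun n => hd n x hx) (hS x hx) n
  have hgeo : Tendsto (fun n : ℕ => 2 * (1 / 4 : ℝ) ^ n / (1 - 1 / 4)) atTop (𝓝 0) := by
    have := tendsto_pow_atTop_nhds_zero_of_lt_one (r := (1 / 4 : ℝ)) (by norm_num) (by norm_num)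
    simpa using (this.const_mul 2).div_const (1 - 1 / 4)
  have hSp : IsProfile r S := by
    constructor
    · have : TendstoUniformlyOn s S atTop (Set.Ioo (-r) r) := by
        rw [Metric.tendstoUniformlyOn_iff]
        intro η hη
        filter_upwards [hgeo.eventually_lt_const hη] with n hn x hx
        rw [dist_comm]
        exact (hdist n x hx).trans_lt hn
      exact this.continuousOn (Frequently.of_forall fun n => (hp n).1)
    · intro x hx
      exact isClosed_Icc.mem_of_tendsto (hS x hx) (Eventually.of_forall fun n => (hp n).2 x hx)
  refine ⟨S, hSp, fun x hx => ?_⟩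
  refine tendsto_nhds_unique ?_ ((hS x hx).comp (tendsto_add_atTop_nat 1))
  rw [tendsto_iff_dist_tendsto_zero]
  refine squeeze_zero (fun _ => dist_nonneg) (fun n => ?_)
    (by simpa only [zero_div] using hgeo.div_const 4)
  simp only [Function.comp, hs1]
  exact hc _ _ _ (hp n) hSp (hdist n) x hx

theorem fixed_profile_unique {r : ℝ} {T : (ℝ → ℝ) → ℝ → ℝ}
    (hc : ∀ S S' δ, IsProfile r S → IsProfile r S' → (∀ x ∈ Set.Ioo (-r) r, |S x - S' x| ≤ δ) →
      ∀ x ∈ Set.Ioo (-r) r, |T S x - T S' x| ≤ δ / 4)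
    {S S' : ℝ → ℝ} (hS : IsProfile r S) (hS' : IsProfile r S')
    (hf : ∀ x ∈ Set.Ioo (-r) r, T S x = S x) (hf' : ∀ x ∈ Set.Ioo (-r) r, T S' x = S' x) :
    ∀ x ∈ Set.Ioo (-r) r, S x = S' x := by
  have hd : ∀ n : ℕ, ∀ x ∈ Set.Ioo (-r) r, |S x - S' x| ≤ 2 * (1 / 4 : ℝ) ^ n := by
    intro n
    induction n with
    | zero =>
      intro x hx
      have h1 := hS.2 x hx
      have h2 := hS'.2 x hx
      rw [abs_le]
      constructor <;> norm_num <;> linarith [h1.1, h1.2, h2.1, h2.2]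
    | succ n ih =>
      intro x hx
      rw [← hf x hx, ← hf' x hx]
      refine (hc _ _ _ hS hS' ih x hx).trans (le_of_eq ?_)
      rw [pow_succ]
      ring
  intro x hx
  have h1 : Tendsto (fun n : ℕ => 2 * (1 / 4 : ℝ) ^ n) atTop (𝓝 0) := by
    simpa using (tendsto_pow_atTop_nhds_zero_of_lt_one (r := (1 / 4 : ℝ)) (by norm_num)
      (by norm_num)).const_mul 2
  have h2 : |S x - S' x| ≤ 0 := ge_of_tendsto' h1 fun n => hd n x hx
  exact sub_eq_zero.1 (abs_nonpos_iff.1 h2)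

/-! ### Integrals weighted by the arc -/

section Weighted

variable {κ r : ℝ}

theorem arcProfile_nonneg (hκ : 0 < κ) {x : ℝ} (hx : x ∈ Set.Icc (-r) r) :
    0 ≤ arcProfile κ r x := by
  have : 0 ≤ r ^ 2 - x ^ 2 := by nlinarith [hx.1, hx.2]
  unfold arcProfile
  positivity

theorem arcProfile_pos (hκ : 0 < κ) {x : ℝ} (hx : x ∈ Set.Ioo (-r) r) :
    0 < arcProfile κ r x := by
  have : 0 < r ^ 2 - x ^ 2 := by nlinarith [hx.1, hx.2]
  unfold arcProfile
  positivity

theorem arcProfile_le (hκ : 0 < κ) (x : ℝ) : arcProfile κ r x ≤ κ * r ^ 2 := by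
  unfold arcProfile
  nlinarith [mul_nonneg hκ.le (sq_nonneg x)]

theorem continuous_arcProfile : Continuous (arcProfile κ r) := by
  unfold arcProfile
  fun_prop

theorem intervalIntegrable_mul_arcProfile {h : ℝ → ℝ} {M : ℝ}
    (hc : ContinuousOn h (Set.Ioo (-r) r)) (hM : ∀ x ∈ Set.Ioo (-r) r, |h x| ≤ M)
    {x y : ℝ} (hx : x ∈ Set.Icc (-r) r) (hy : y ∈ Set.Icc (-r) r) :
    IntervalIntegrable (fun ξ => h ξ * arcProfile κ r ξ) MeasureTheory.volume x y := by
  have h1 : IntervalIntegrable h MeasureTheory.volume (-r) r := by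
    rw [intervalIntegrable_iff_integrableOn_Ioo_of_le (hx.1.trans hx.2)]
    refine MeasureTheory.IntegrableOn.of_bound (by simp) (hc.aestronglyMeasurable measurableSet_Ioo)
      M ?_
    filter_upwards [MeasureTheory.ae_restrict_mem measurableSet_Ioo] with z hz
    exact hM z hz
  refine (h1.mul_continuousOn continuous_arcProfile.continuousOn).mono_set ?_
  rw [Set.uIcc_of_le (hx.1.trans hx.2)]
  exact Set.uIcc_subset_Icc hx hy

/-- The weight vanishes to first order at `-r`, so its integral vanishes to second order, exactly as
`arcProfile²` does. -/
theorem abs_integral_left_le (hκ : 0 < κ) (hr : 0 < r) {h : ℝ → ℝ} {M : ℝ}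
    (hM : ∀ x ∈ Set.Ioo (-r) r, |h x| ≤ M) {x : ℝ} (hx : -r < x) (hx0 : x ≤ 0) :
    |∫ ξ in (-r)..x, h ξ * arcProfile κ r ξ| ≤ M * (2 / (κ * r)) * arcProfile κ r x ^ 2 := by
  have hM0 : 0 ≤ M := (abs_nonneg _).trans (hM x ⟨hx, by linarith⟩)
  have h1 := intervalIntegral.norm_integral_le_of_norm_le_const (a := -r) (b := x)
    (C := M * (2 * κ * r * (x + r))) (f := fun ξ => h ξ * arcProfile κ r ξ) (fun ξ hξ => by
      rw [Set.uIoc_of_le hx.le] at hξ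
      have h2 : ξ < r := by linarith [hξ.2]
      rw [Real.norm_eq_abs, abs_mul, abs_of_nonneg (arcProfile_nonneg hκ ⟨hξ.1.le, h2.le⟩)]
      refine mul_le_mul (hM ξ ⟨hξ.1, h2⟩) ?_ (arcProfile_nonneg hκ ⟨hξ.1.le, h2.le⟩) hM0
      have h3 : 0 ≤ κ * (ξ + r) ^ 2 := by positivity
      have h4 : κ * r * (ξ + r) ≤ κ * r * (x + r) := by gcongr; exact hξ.2
      unfold arcProfile
      nlinarith)
  rw [Real.norm_eq_abs, sub_neg_eq_add, abs_of_nonneg (by linarith : 0 ≤ x + r)] at h1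
  have h2 : κ * r * (x + r) ≤ arcProfile κ r x := by
    have : 0 ≤ (x + r) * (-x) := mul_nonneg (by linarith) (by linarith)
    have : 0 ≤ κ * ((x + r) * (-x)) := by positivity
    unfold arcProfile
    nlinarith
  have h3 : (κ * r * (x + r)) ^ 2 ≤ arcProfile κ r x ^ 2 := by
    have : 0 ≤ κ * r * (x + r) := mul_nonneg (by positivity) (by linarith)
    gcongr
  calc _ ≤ _ := h1
    _ = M * (2 / (κ * r)) * (κ * r * (x + r)) ^ 2 := by field_simp
    _ ≤ _ := by gcongr

/-- Vanishing of the total integral allows integration from the right end instead, so the quotient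
by `arcProfile²` is bounded near `r` as well. -/
theorem abs_integral_le (hκ : 0 < κ) (hr : 0 < r) {h : ℝ → ℝ} {M : ℝ}
    (hc : ContinuousOn h (Set.Ioo (-r) r)) (hM : ∀ x ∈ Set.Ioo (-r) r, |h x| ≤ M)
    (h0 : ∫ ξ in (-r)..r, h ξ * arcProfile κ r ξ = 0) {x : ℝ} (hx : x ∈ Set.Ioo (-r) r) :
    |∫ ξ in (-r)..x, h ξ * arcProfile κ r ξ| ≤ M * (2 / (κ * r)) * arcProfile κ r x ^ 2 := by
  rcases le_total x 0 with hx0 | hx0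
  · exact abs_integral_left_le hκ hr hM hx.1 hx0
  have hA : ∀ z, arcProfile κ r (-z) = arcProfile κ r z := fun z => by simp [arcProfile]
  have hr' : -r ≤ r := by linarith
  have h1 := abs_integral_left_le (x := -x) hκ hr (h := fun z => h (-z)) (M := M)
    (fun z hz => hM _ ⟨by linarith [hz.2], by linarith [hz.1]⟩) (by linarith [hx.2]) (by linarith)
  have h2 := intervalIntegral.integral_add_adjacent_intervals
    (intervalIntegrable_mul_arcProfile (κ := κ) hc hM ⟨le_rfl, hr'⟩ ⟨hx.1.le, hx.2.le⟩)
    (intervalIntegrable_mul_arcProfile (κ := κ) hc hM ⟨hx.1.le, hx.2.le⟩ ⟨hr', le_rfl⟩)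
  have h3 := intervalIntegral.integral_comp_neg (a := -r) (b := -x)
    fun ξ => h ξ * arcProfile κ r ξ
  simp only [neg_neg, hA] at h1 h3
  rw [h3] at h1
  rwa [show ∫ ξ in (-r)..x, h ξ * arcProfile κ r ξ = -∫ ξ in x..r, h ξ * arcProfile κ r ξ by
    linarith, abs_neg]

theorem abs_integral_full_le (hκ : 0 < κ) (hr : 0 < r) {h : ℝ → ℝ} {M : ℝ}
    (hM : ∀ x ∈ Set.Ioo (-r) r, |h x| ≤ M) :
    |∫ ξ in (-r)..r, h ξ * arcProfile κ r ξ| ≤ M * (2 * κ * r ^ 3) := by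
  have hM0 : 0 ≤ M := (abs_nonneg _).trans (hM 0 ⟨by linarith, hr⟩)
  have h1 := intervalIntegral.norm_integral_le_of_norm_le_const_ae (a := -r) (b := r)
    (C := M * (κ * r ^ 2)) (f := fun ξ => h ξ * arcProfile κ r ξ) (by
      -- The bound on `h` holds only on the open interval, so the end point `r` is discarded as a
      -- null set.
      filter_upwards [MeasureTheory.Measure.ae_ne MeasureTheory.volume r] with ξ hne hξ
      rw [Set.uIoc_of_le (by linarith)] at hξ
      have hξ' : ξ ∈ Set.Ioo (-r) r := ⟨hξ.1, lt_of_le_of_ne hξ.2 hne⟩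
      rw [Real.norm_eq_abs, abs_mul, abs_of_nonneg (arcProfile_pos hκ hξ').le]
      exact mul_le_mul (hM ξ hξ') (arcProfile_le hκ ξ) (arcProfile_pos hκ hξ').le hM0)
  rw [Real.norm_eq_abs, abs_of_nonneg (by linarith : 0 ≤ r - -r)] at h1
  linarith

end Weighted

/-! ### The balancing coefficient and the profile map -/

/-- A nonlinearity that is bounded by `M` and `M`-Lipschitz along profiles. -/
structure IsReaction (r M : ℝ) (n : ℝ → ℝ → ℝ) : Prop where
  cont : Continuous fun p : ℝ × ℝ => n p.1 p.2
  bound : ∀ x ∈ Set.Ioo (-r) r, ∀ σ ∈ Set.Icc (1 / 2 : ℝ) 2, |n x σ| ≤ M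
  lip : ∀ x ∈ Set.Ioo (-r) r, ∀ σ ∈ Set.Icc (1 / 2 : ℝ) 2, ∀ σ' ∈ Set.Icc (1 / 2 : ℝ) 2,
    |n x σ - n x σ'| ≤ M * |σ - σ'|

/-- The weighted integral of `x² S(x)`. -/
noncomputable def weightIntegral (κ r : ℝ) (S : ℝ → ℝ) : ℝ :=
  ∫ ξ in (-r)..r, ξ ^ 2 * S ξ * arcProfile κ r ξ

/-- The weighted integral of the nonlinearity along a profile. -/
noncomputable def reactionIntegral (κ r : ℝ) (n : ℝ → ℝ → ℝ) (S : ℝ → ℝ) : ℝ :=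
  ∫ ξ in (-r)..r, n ξ (S ξ) * arcProfile κ r ξ

/-- The coefficient of `x²` that makes the total energy gain along the profile vanish. -/
noncomputable def balanceCoeff (κ r : ℝ) (n : ℝ → ℝ → ℝ) (S : ℝ → ℝ) : ℝ :=
  -reactionIntegral κ r n S / weightIntegral κ r S

/-- The density of the energy gain along a profile, with the balancing coefficient. -/
noncomputable def balancedSource (κ r : ℝ) (n : ℝ → ℝ → ℝ) (S : ℝ → ℝ) (ξ : ℝ) : ℝ :=
  n ξ (S ξ) + balanceCoeff κ r n S * (ξ ^ 2 * S ξ)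

/-- The energy gain along a profile up to `x`. -/
noncomputable def energyGain (κ r : ℝ) (n : ℝ → ℝ → ℝ) (S : ℝ → ℝ) (x : ℝ) : ℝ :=
  ∫ ξ in (-r)..x, balancedSource κ r n S ξ * arcProfile κ r ξ

/-- The map whose fixed points are the profiles of connections. -/
noncomputable def profileMap (κ r ε : ℝ) (n : ℝ → ℝ → ℝ) (S : ℝ → ℝ) (x : ℝ) : ℝ :=
  √(1 + 2 * ε * (energyGain κ r n S x / arcProfile κ r x ^ 2))

section

variable {κ r M δ : ℝ} {n : ℝ → ℝ → ℝ} {S S' : ℝ → ℝ}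

theorem isProfile_one : IsProfile r fun _ => 1 :=
  ⟨continuousOn_const, fun _ _ => by norm_num⟩

theorem sq_le_of_mem {x : ℝ} (hx : x ∈ Set.Ioo (-r) r) : x ^ 2 ≤ r ^ 2 := by
  nlinarith [hx.1, hx.2]

theorem IsReaction.continuousOn (hn : IsReaction r M n) (hS : IsProfile r S) :
    ContinuousOn (fun ξ => n ξ (S ξ)) (Set.Ioo (-r) r) :=
  hn.cont.comp_continuousOn (continuousOn_id.prodMk hS.1)

theorem IsProfile.continuousOn_weight (hS : IsProfile r S) :
    ContinuousOn (fun ξ => ξ ^ 2 * S ξ) (Set.Ioo (-r) r) :=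
  (continuousOn_id.pow 2).mul hS.1

theorem IsProfile.abs_weight_le (hS : IsProfile r S) {x : ℝ} (hx : x ∈ Set.Ioo (-r) r) :
    |x ^ 2 * S x| ≤ 2 * r ^ 2 := by
  have h1 := hS.2 x hx
  rw [abs_of_nonneg (mul_nonneg (sq_nonneg x) (by linarith [h1.1]))]
  calc x ^ 2 * S x ≤ r ^ 2 * 2 :=
        mul_le_mul (sq_le_of_mem hx) h1.2 (by linarith [h1.1]) (sq_nonneg r)
    _ = 2 * r ^ 2 := by ring

theorem IsProfile.abs_weight_sub_le
    (hδ : ∀ x ∈ Set.Ioo (-r) r, |S x - S' x| ≤ δ) {x : ℝ} (hx : x ∈ Set.Ioo (-r) r) :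
    |x ^ 2 * S x - x ^ 2 * S' x| ≤ r ^ 2 * δ := by
  rw [← mul_sub, abs_mul, abs_of_nonneg (sq_nonneg x)]
  exact mul_le_mul (sq_le_of_mem hx) (hδ x hx) (abs_nonneg _) (sq_nonneg r)

theorem IsReaction.nonneg (hr : 0 < r) (hn : IsReaction r M n) : 0 ≤ M :=
  (abs_nonneg _).trans (hn.bound 0 ⟨by linarith, hr⟩ 1 (by norm_num))

theorem IsReaction.abs_sub_le (hr : 0 < r) (hn : IsReaction r M n) (hS : IsProfile r S)
    (hS' : IsProfile r S') (hδ : ∀ x ∈ Set.Ioo (-r) r, |S x - S' x| ≤ δ) {x : ℝ}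
    (hx : x ∈ Set.Ioo (-r) r) : |n x (S x) - n x (S' x)| ≤ M * δ :=
  (hn.lip x hx _ (hS.2 x hx) _ (hS'.2 x hx)).trans
    (mul_le_mul_of_nonneg_left (hδ x hx) (hn.nonneg hr))

/-- Profiles are at least `1/2`. The bound is uniform in `S` and controls the denominator of the
balancing coefficient. -/
theorem weightIntegral_lower (hκ : 0 < κ) (hr : 0 < r) (hS : IsProfile r S) :
    2 * κ * r ^ 5 / 15 ≤ weightIntegral κ r S := by
  have hr' : -r ≤ r := by linarith
  have h1 : ∫ ξ in (-r)..r, ξ ^ 2 * (1 / 2) * arcProfile κ r ξ = 2 * κ * r ^ 5 / 15 := by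
    have : ∀ ξ : ℝ, ξ ^ 2 * (1 / 2) * arcProfile κ r ξ
        = κ * r ^ 2 / 2 * ξ ^ 2 - κ / 2 * ξ ^ 4 := fun ξ => by unfold arcProfile; ring
    simp only [this]
    rw [intervalIntegral.integral_sub ((by fun_prop : Continuous _).intervalIntegrable _ _)
      ((by fun_prop : Continuous _).intervalIntegrable _ _)]
    rw [intervalIntegral.integral_const_mul, intervalIntegral.integral_const_mul, integral_pow,
      integral_pow]
    norm_num
    ring
  rw [← h1]
  refine intervalIntegral.integral_mono_on_of_le_Ioo hr'
    ((by unfold arcProfile; fun_prop : Continuous _).intervalIntegrable _ _)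
    (intervalIntegrable_mul_arcProfile hS.continuousOn_weight (fun x hx => hS.abs_weight_le hx)
      ⟨le_rfl, hr'⟩ ⟨hr', le_rfl⟩) fun x hx => ?_
  have := (hS.2 x hx).1
  have := arcProfile_pos hκ hx
  gcongr

theorem weightIntegral_pos (hκ : 0 < κ) (hr : 0 < r) (hS : IsProfile r S) :
    0 < weightIntegral κ r S :=
  lt_of_lt_of_le (by positivity) (weightIntegral_lower hκ hr hS)

theorem abs_weightIntegral_sub_le (hκ : 0 < κ) (hr : 0 < r) (hS : IsProfile r S)
    (hS' : IsProfile r S') (hδ : ∀ x ∈ Set.Ioo (-r) r, |S x - S' x| ≤ δ) :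
    |weightIntegral κ r S - weightIntegral κ r S'| ≤ r ^ 2 * δ * (2 * κ * r ^ 3) := by
  have hr' : -r ≤ r := by linarith
  have h1 := abs_integral_full_le hκ hr (h := fun ξ => ξ ^ 2 * S ξ - ξ ^ 2 * S' ξ)
    fun x hx => IsProfile.abs_weight_sub_le hδ hx
  simp only [sub_mul] at h1
  rwa [intervalIntegral.integral_sub
    (intervalIntegrable_mul_arcProfile hS.continuousOn_weight (fun x hx => hS.abs_weight_le hx)
      ⟨le_rfl, hr'⟩ ⟨hr', le_rfl⟩)
    (intervalIntegrable_mul_arcProfile hS'.continuousOn_weight (fun x hx => hS'.abs_weight_le hx)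
      ⟨le_rfl, hr'⟩ ⟨hr', le_rfl⟩)] at h1

theorem abs_reactionIntegral_le (hκ : 0 < κ) (hr : 0 < r) (hn : IsReaction r M n)
    (hS : IsProfile r S) : |reactionIntegral κ r n S| ≤ M * (2 * κ * r ^ 3) :=
  abs_integral_full_le hκ hr fun x hx => hn.bound x hx _ (hS.2 x hx)

theorem abs_reactionIntegral_sub_le (hκ : 0 < κ) (hr : 0 < r) (hn : IsReaction r M n)
    (hS : IsProfile r S) (hS' : IsProfile r S') (hδ : ∀ x ∈ Set.Ioo (-r) r, |S x - S' x| ≤ δ) :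
    |reactionIntegral κ r n S - reactionIntegral κ r n S'| ≤ M * δ * (2 * κ * r ^ 3) := by
  have hr' : -r ≤ r := by linarith
  have h1 := abs_integral_full_le hκ hr (h := fun ξ => n ξ (S ξ) - n ξ (S' ξ))
    fun x hx => hn.abs_sub_le hr hS hS' hδ hx
  simp only [sub_mul] at h1
  rwa [intervalIntegral.integral_sub
    (intervalIntegrable_mul_arcProfile (hn.continuousOn hS)
      (fun x hx => hn.bound x hx _ (hS.2 x hx)) ⟨le_rfl, hr'⟩ ⟨hr', le_rfl⟩)
    (intervalIntegrable_mul_arcProfile (hn.continuousOn hS')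
      (fun x hx => hn.bound x hx _ (hS'.2 x hx)) ⟨le_rfl, hr'⟩ ⟨hr', le_rfl⟩)] at h1

theorem abs_balanceCoeff_le (hκ : 0 < κ) (hr : 0 < r) (hn : IsReaction r M n)
    (hS : IsProfile r S) : |balanceCoeff κ r n S| ≤ 15 * M / r ^ 2 := by
  have h1 := weightIntegral_lower hκ hr hS
  have h2 := weightIntegral_pos hκ hr hS
  have hM := hn.nonneg hr
  rw [balanceCoeff, abs_div, abs_neg, abs_of_pos h2, div_le_iff₀ h2]
  calc _ ≤ _ := abs_reactionIntegral_le hκ hr hn hS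
    _ = 15 * M / r ^ 2 * (2 * κ * r ^ 5 / 15) := by field_simp
    _ ≤ _ := by gcongr

theorem abs_balanceCoeff_sub_le (hκ : 0 < κ) (hr : 0 < r) (hn : IsReaction r M n)
    (hS : IsProfile r S) (hS' : IsProfile r S') (hδ : ∀ x ∈ Set.Ioo (-r) r, |S x - S' x| ≤ δ) :
    |balanceCoeff κ r n S - balanceCoeff κ r n S'| ≤ 240 * M * δ / r ^ 2 := by
  have h1 := weightIntegral_lower hκ hr hS
  have h2 := weightIntegral_pos hκ hr hS
  have h2' := weightIntegral_pos hκ hr hS'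
  have hM := hn.nonneg hr
  have hδ0 : 0 ≤ δ := (abs_nonneg _).trans (hδ 0 ⟨by linarith, hr⟩)
  -- A difference of quotients over a single denominator. The two terms contribute `1 + 15` units of
  -- `M δ · 2κr³`, whence `240 = 15 · 16`.
  have e : balanceCoeff κ r n S - balanceCoeff κ r n S' =
      (-(reactionIntegral κ r n S - reactionIntegral κ r n S')
        - balanceCoeff κ r n S' * (weightIntegral κ r S - weightIntegral κ r S')) /
        weightIntegral κ r S := by
    unfold balanceCoeff
    field_simp
    ring
  rw [e, abs_div, abs_of_pos h2, div_le_iff₀ h2]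
  have h3 := abs_reactionIntegral_sub_le hκ hr hn hS hS' hδ
  have h4 := abs_weightIntegral_sub_le hκ hr hS hS' hδ
  have h5 := abs_balanceCoeff_le hκ hr hn hS'
  calc _ ≤ |-(reactionIntegral κ r n S - reactionIntegral κ r n S')|
        + |balanceCoeff κ r n S' * (weightIntegral κ r S - weightIntegral κ r S')| := abs_sub _ _
    _ ≤ M * δ * (2 * κ * r ^ 3) + 15 * M / r ^ 2 * (r ^ 2 * δ * (2 * κ * r ^ 3)) := by
        rw [abs_neg, abs_mul]
        gcongr
    _ = 240 * M * δ / r ^ 2 * (2 * κ * r ^ 5 / 15) := by field_simp; ring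
    _ ≤ _ := by gcongr

theorem continuousOn_balancedSource (hn : IsReaction r M n) (hS : IsProfile r S) :
    ContinuousOn (balancedSource κ r n S) (Set.Ioo (-r) r) :=
  (hn.continuousOn hS).add (continuousOn_const.mul hS.continuousOn_weight)

theorem abs_balancedSource_le (hκ : 0 < κ) (hr : 0 < r) (hn : IsReaction r M n)
    (hS : IsProfile r S) {x : ℝ} (hx : x ∈ Set.Ioo (-r) r) :
    |balancedSource κ r n S x| ≤ 31 * M := by
  have hM := hn.nonneg hr
  calc _ ≤ |n x (S x)| + |balanceCoeff κ r n S * (x ^ 2 * S x)| := abs_add_le _ _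
    _ ≤ M + 15 * M / r ^ 2 * (2 * r ^ 2) := by
        rw [abs_mul]
        gcongr
        · exact hn.bound x hx _ (hS.2 x hx)
        · exact abs_balanceCoeff_le hκ hr hn hS
        · exact hS.abs_weight_le hx
    _ = 31 * M := by field_simp; ring

theorem abs_balancedSource_sub_le (hκ : 0 < κ) (hr : 0 < r) (hn : IsReaction r M n)
    (hS : IsProfile r S) (hS' : IsProfile r S') (hδ : ∀ x ∈ Set.Ioo (-r) r, |S x - S' x| ≤ δ)
    {x : ℝ} (hx : x ∈ Set.Ioo (-r) r) :
    |balancedSource κ r n S x - balancedSource κ r n S' x| ≤ 500 * M * δ := by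
  have hM := hn.nonneg hr
  have hδ0 : 0 ≤ δ := (abs_nonneg _).trans (hδ 0 ⟨by linarith, hr⟩)
  have e : balancedSource κ r n S x - balancedSource κ r n S' x = (n x (S x) - n x (S' x))
      + ((balanceCoeff κ r n S - balanceCoeff κ r n S') * (x ^ 2 * S x)
        + balanceCoeff κ r n S' * (x ^ 2 * S x - x ^ 2 * S' x)) := by
    unfold balancedSource
    ring
  rw [e]
  calc _ ≤ |n x (S x) - n x (S' x)|
        + (|(balanceCoeff κ r n S - balanceCoeff κ r n S') * (x ^ 2 * S x)|
        + |balanceCoeff κ r n S' * (x ^ 2 * S x - x ^ 2 * S' x)|) :=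
        (abs_add_le _ _).trans (add_le_add_right (abs_add_le _ _) _)
    _ ≤ M * δ + (240 * M * δ / r ^ 2 * (2 * r ^ 2) + 15 * M / r ^ 2 * (r ^ 2 * δ)) := by
        rw [abs_mul (_ - _), abs_mul (balanceCoeff κ r n S')]
        gcongr
        · exact hn.abs_sub_le hr hS hS' hδ hx
        · exact abs_balanceCoeff_sub_le hκ hr hn hS hS' hδ
        · exact hS.abs_weight_le hx
        · exact abs_balanceCoeff_le hκ hr hn hS'
        · exact IsProfile.abs_weight_sub_le hδ hx
    _ = 496 * M * δ := by field_simp; ring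
    _ ≤ 500 * M * δ := by gcongr; norm_num

theorem intervalIntegrable_balancedSource (hκ : 0 < κ) (hr : 0 < r) (hn : IsReaction r M n)
    (hS : IsProfile r S) {x y : ℝ} (hx : x ∈ Set.Icc (-r) r) (hy : y ∈ Set.Icc (-r) r) :
    IntervalIntegrable (fun ξ => balancedSource κ r n S ξ * arcProfile κ r ξ)
      MeasureTheory.volume x y :=
  intervalIntegrable_mul_arcProfile (continuousOn_balancedSource hn hS)
    (fun _ hx => abs_balancedSource_le hκ hr hn hS hx) hx hy

/-- The balancing coefficient is chosen for this: it is the hypothesis under which the weighted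
estimate holds up to the right saddle. -/
theorem energyGain_right (hκ : 0 < κ) (hr : 0 < r) (hn : IsReaction r M n) (hS : IsProfile r S) :
    energyGain κ r n S r = 0 := by
  have hr' : -r ≤ r := by linarith
  have h2 := weightIntegral_pos hκ hr hS
  unfold energyGain balancedSource
  simp only [add_mul, mul_assoc (balanceCoeff κ r n S)]
  rw [intervalIntegral.integral_add
    (intervalIntegrable_mul_arcProfile (hn.continuousOn hS)
      (fun x hx => hn.bound x hx _ (hS.2 x hx)) ⟨le_rfl, hr'⟩ ⟨hr', le_rfl⟩)
    ((intervalIntegrable_mul_arcProfile hS.continuousOn_weight (fun x hx => hS.abs_weight_le hx)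
      ⟨le_rfl, hr'⟩ ⟨hr', le_rfl⟩).const_mul _), intervalIntegral.integral_const_mul]
  change reactionIntegral κ r n S + balanceCoeff κ r n S * weightIntegral κ r S = 0
  unfold balanceCoeff
  field_simp
  ring

theorem abs_energyGain_le (hκ : 0 < κ) (hr : 0 < r) (hn : IsReaction r M n) (hS : IsProfile r S)
    {x : ℝ} (hx : x ∈ Set.Ioo (-r) r) :
    |energyGain κ r n S x / arcProfile κ r x ^ 2| ≤ 1000 / (κ * r) * M := by
  have hA := arcProfile_pos hκ hx
  have hM := hn.nonneg hr
  rw [abs_div, abs_of_pos (pow_pos hA 2), div_le_iff₀ (pow_pos hA 2)]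
  calc _ ≤ 31 * M * (2 / (κ * r)) * arcProfile κ r x ^ 2 :=
        abs_integral_le hκ hr (continuousOn_balancedSource hn hS)
          (fun x hx => abs_balancedSource_le hκ hr hn hS hx) (energyGain_right hκ hr hn hS) hx
    _ = 62 / (κ * r) * M * arcProfile κ r x ^ 2 := by ring
    _ ≤ _ := by gcongr; norm_num

theorem abs_energyGain_sub_le (hκ : 0 < κ) (hr : 0 < r) (hn : IsReaction r M n)
    (hS : IsProfile r S) (hS' : IsProfile r S') (hδ : ∀ x ∈ Set.Ioo (-r) r, |S x - S' x| ≤ δ)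
    {x : ℝ} (hx : x ∈ Set.Ioo (-r) r) :
    |energyGain κ r n S x / arcProfile κ r x ^ 2 - energyGain κ r n S' x / arcProfile κ r x ^ 2|
      ≤ 1000 / (κ * r) * M * δ := by
  have hA := arcProfile_pos hκ hx
  have hr' : -r ≤ r := by linarith
  have hsub : ∀ y ∈ Set.Icc (-r) r, ∫ ξ in (-r)..y, (balancedSource κ r n S ξ
      - balancedSource κ r n S' ξ) * arcProfile κ r ξ
      = energyGain κ r n S y - energyGain κ r n S' y := by
    intro y hy
    simp only [sub_mul]
    exact intervalIntegral.integral_sub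
      (intervalIntegrable_balancedSource hκ hr hn hS ⟨le_rfl, hr'⟩ hy)
      (intervalIntegrable_balancedSource hκ hr hn hS' ⟨le_rfl, hr'⟩ hy)
  rw [← sub_div, abs_div, abs_of_pos (pow_pos hA 2), div_le_iff₀ (pow_pos hA 2),
    ← hsub x ⟨hx.1.le, hx.2.le⟩]
  refine (abs_integral_le hκ hr ((continuousOn_balancedSource hn hS).sub
    (continuousOn_balancedSource hn hS'))
    (fun x hx => abs_balancedSource_sub_le hκ hr hn hS hS' hδ hx) ?_ hx).trans (le_of_eq (by ring))
  refine (hsub r ⟨hr', le_rfl⟩).trans ?_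
  rw [energyGain_right hκ hr hn hS, energyGain_right hκ hr hn hS', sub_zero]

theorem continuousOn_energyGain (hκ : 0 < κ) (hr : 0 < r) (hn : IsReaction r M n)
    (hS : IsProfile r S) : ContinuousOn (energyGain κ r n S) (Set.Icc (-r) r) := by
  have hr' : -r ≤ r := by linarith
  have := intervalIntegral.continuousOn_primitive_interval (a := -r) (b := r)
    ((intervalIntegrable_iff' ).1
      (intervalIntegrable_balancedSource hκ hr hn hS ⟨le_rfl, hr'⟩ ⟨hr', le_rfl⟩))
  rwa [Set.uIcc_of_le hr'] at this

variable {ε : ℝ}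

theorem abs_sqrt_one_add_sub_le {u v : ℝ} (hu : |u| ≤ 1 / 4) (hv : |v| ≤ 1 / 4) :
    |√(1 + u) - √(1 + v)| ≤ |u - v| := by
  have hu' := abs_le.1 hu
  have hv' := abs_le.1 hv
  have h1 : 1 / 2 ≤ √(1 + u) := Real.le_sqrt_of_sq_le (by linarith)
  have h2 : 1 / 2 ≤ √(1 + v) := Real.le_sqrt_of_sq_le (by linarith)
  have e : u - v = (√(1 + u) - √(1 + v)) * (√(1 + u) + √(1 + v)) := by
    have h3 := Real.sq_sqrt (by linarith : 0 ≤ 1 + u)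
    have h4 := Real.sq_sqrt (by linarith : 0 ≤ 1 + v)
    linear_combination h4 - h3
  rw [e, abs_mul]
  refine le_mul_of_one_le_right (abs_nonneg _) ?_
  rw [abs_of_nonneg (by linarith)]
  linarith

/-- The number `8000 = 4 · 2 · 1000` serves twice: it keeps the radicand in `[3/4, 5/4]`, and it
makes the contraction factor `1/4`. -/
theorem abs_gain_le (hκ : 0 < κ) (hr : 0 < r) (hn : IsReaction r M n)
    (hε : |ε| * (8000 / (κ * r) * M) ≤ 1) (hS : IsProfile r S) {x : ℝ} (hx : x ∈ Set.Ioo (-r) r) :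
    |2 * ε * (energyGain κ r n S x / arcProfile κ r x ^ 2)| ≤ 1 / 4 := by
  rw [abs_mul, abs_mul, abs_two]
  calc _ ≤ 2 * |ε| * (1000 / (κ * r) * M) := by gcongr; exact abs_energyGain_le hκ hr hn hS hx
    _ = |ε| * (8000 / (κ * r) * M) / 4 := by ring
    _ ≤ 1 / 4 := by linarith

theorem isProfile_profileMap (hκ : 0 < κ) (hr : 0 < r) (hn : IsReaction r M n)
    (hε : |ε| * (8000 / (κ * r) * M) ≤ 1) (hS : IsProfile r S) :
    IsProfile r (profileMap κ r ε n S) := by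
  constructor
  · refine Real.continuous_sqrt.comp_continuousOn (continuousOn_const.add
      (continuousOn_const.mul (ContinuousOn.div ((continuousOn_energyGain hκ hr hn hS).mono
        Set.Ioo_subset_Icc_self) (continuous_arcProfile.pow 2).continuousOn fun x hx => ?_)))
    exact (pow_pos (arcProfile_pos hκ hx) 2).ne'
  · intro x hx
    have := abs_le.1 (abs_gain_le hκ hr hn hε hS hx)
    exact ⟨Real.le_sqrt_of_sq_le (by linarith), Real.sqrt_le_iff.2 ⟨by norm_num, by linarith⟩⟩

theorem profileMap_contracts (hκ : 0 < κ) (hr : 0 < r) (hn : IsReaction r M n)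
    (hε : |ε| * (8000 / (κ * r) * M) ≤ 1) (hS : IsProfile r S) (hS' : IsProfile r S')
    (hδ : ∀ x ∈ Set.Ioo (-r) r, |S x - S' x| ≤ δ) {x : ℝ} (hx : x ∈ Set.Ioo (-r) r) :
    |profileMap κ r ε n S x - profileMap κ r ε n S' x| ≤ δ / 4 := by
  have hδ0 : 0 ≤ δ := (abs_nonneg _).trans (hδ 0 ⟨by linarith, hr⟩)
  refine (abs_sqrt_one_add_sub_le (abs_gain_le hκ hr hn hε hS hx)
    (abs_gain_le hκ hr hn hε hS' hx)).trans ?_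
  rw [← mul_sub, abs_mul, abs_mul, abs_two]
  calc _ ≤ 2 * |ε| * (1000 / (κ * r) * M * δ) := by
        gcongr; exact abs_energyGain_sub_le hκ hr hn hS hS' hδ hx
    _ = |ε| * (8000 / (κ * r) * M) * (δ / 4) := by ring
    _ ≤ 1 * (δ / 4) := by gcongr
    _ = δ / 4 := one_mul _

theorem abs_profileMap_sub_one_le (hκ : 0 < κ) (hr : 0 < r) (hn : IsReaction r M n)
    (hε : |ε| * (8000 / (κ * r) * M) ≤ 1) (hS : IsProfile r S) {x : ℝ} (hx : x ∈ Set.Ioo (-r) r) :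
    |profileMap κ r ε n S x - 1| ≤ 2000 / (κ * r) * M * |ε| := by
  have := abs_sqrt_one_add_sub_le (abs_gain_le hκ hr hn hε hS hx) (v := 0) (by norm_num)
  rw [add_zero, Real.sqrt_one, sub_zero] at this
  refine this.trans ?_
  rw [abs_mul, abs_mul, abs_two]
  calc _ ≤ 2 * |ε| * (1000 / (κ * r) * M) := by gcongr; exact abs_energyGain_le hκ hr hn hS hx
    _ = _ := by ring

/-- `S` is the profile of a balanced graph. -/
def IsBalancedProfile (κ r ε : ℝ) (n : ℝ → ℝ → ℝ) (S : ℝ → ℝ) : Prop :=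
  IsProfile r S ∧ ∀ x ∈ Set.Ioo (-r) r, profileMap κ r ε n S x = S x

theorem exists_isBalancedProfile (hκ : 0 < κ) (hr : 0 < r) (hn : IsReaction r M n)
    (hε : |ε| * (8000 / (κ * r) * M) ≤ 1) : ∃ S, IsBalancedProfile κ r ε n S :=
  exists_fixed_profile (fun _ hS => isProfile_profileMap hκ hr hn hε hS)
    fun _ _ _ hS hS' hδ _ hx => profileMap_contracts hκ hr hn hε hS hS' hδ hx

theorem IsBalancedProfile.unique (hκ : 0 < κ) (hr : 0 < r) (hn : IsReaction r M n)
    (hε : |ε| * (8000 / (κ * r) * M) ≤ 1) (hS : IsBalancedProfile κ r ε n S)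
    (hS' : IsBalancedProfile κ r ε n S') : ∀ x ∈ Set.Ioo (-r) r, S x = S' x :=
  fixed_profile_unique (T := profileMap κ r ε n)
    (fun _ _ _ hS hS' hδ _ hx => profileMap_contracts hκ hr hn hε hS hS' hδ hx)
    hS.1 hS'.1 hS.2 hS'.2

theorem IsBalancedProfile.abs_sub_one_le (hκ : 0 < κ) (hr : 0 < r) (hn : IsReaction r M n)
    (hε : |ε| * (8000 / (κ * r) * M) ≤ 1) (hS : IsBalancedProfile κ r ε n S) :
    ∀ x ∈ Set.Ioo (-r) r, |S x - 1| ≤ 2000 / (κ * r) * M * |ε| := by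
  intro x hx
  rw [← hS.2 x hx]
  exact abs_profileMap_sub_one_le hκ hr hn hε hS.1 hx

/-- Profiles are unique only on the open interval; the Lipschitz estimate with `δ = 0` ignores the
values elsewhere. -/
theorem IsBalancedProfile.balanceCoeff_eq (hκ : 0 < κ) (hr : 0 < r) (hn : IsReaction r M n)
    (hε : |ε| * (8000 / (κ * r) * M) ≤ 1) (hS : IsBalancedProfile κ r ε n S)
    (hS' : IsBalancedProfile κ r ε n S') : balanceCoeff κ r n S = balanceCoeff κ r n S' := by
  have := abs_balanceCoeff_sub_le hκ hr hn hS.1 hS'.1 (δ := 0) fun x hx => by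
    rw [hS.unique hκ hr hn hε hS' x hx, sub_self, abs_zero]
  rw [mul_zero, zero_div] at this
  exact sub_eq_zero.1 (abs_nonpos_iff.1 this)

theorem IsBalancedProfile.abs_balanceCoeff_sub_one_le (hκ : 0 < κ) (hr : 0 < r)
    (hn : IsReaction r M n) (hε : |ε| * (8000 / (κ * r) * M) ≤ 1)
    (hS : IsBalancedProfile κ r ε n S) :
    |balanceCoeff κ r n S - balanceCoeff κ r n fun _ => 1| ≤
      480000 * M ^ 2 / (κ * r ^ 3) * |ε| := by
  refine (abs_balanceCoeff_sub_le hκ hr hn hS.1 isProfile_one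
    (hS.abs_sub_one_le hκ hr hn hε)).trans (le_of_eq ?_)
  field_simp
  ring

theorem IsBalancedProfile.sq_eq (hκ : 0 < κ) (hr : 0 < r) (hn : IsReaction r M n)
    (hε : |ε| * (8000 / (κ * r) * M) ≤ 1) (hS : IsBalancedProfile κ r ε n S) {x : ℝ}
    (hx : x ∈ Set.Ioo (-r) r) :
    (arcProfile κ r x * S x) ^ 2 = arcProfile κ r x ^ 2 + 2 * ε * energyGain κ r n S x := by
  have hA := arcProfile_pos hκ hx
  have h1 := abs_le.1 (abs_gain_le hκ hr hn hε hS.1 hx)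
  rw [← hS.2 x hx, profileMap, mul_pow, Real.sq_sqrt (by linarith)]
  field_simp

end

/-! ### From graphs back to orbits -/

/-- A positive function on `(-r, r)` that vanishes linearly at the end points is run through in
infinite time by `x' = U x`. -/
theorem exists_time_parametrization {r C : ℝ} (hr : 0 < r) (hC : 0 < C) {U : ℝ → ℝ}
    (hU : ContinuousOn U (Set.Ioo (-r) r)) (hpos : ∀ x ∈ Set.Ioo (-r) r, 0 < U x)
    (hle : ∀ x ∈ Set.Ioo (-r) r, U x ≤ C * (r ^ 2 - x ^ 2)) :
    ∃ X : ℝ → ℝ, (∀ t, X t ∈ Set.Ioo (-r) r) ∧ (∀ z ∈ Set.Ioo (-r) r, ∃ t, X t = z) ∧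
      (∀ t, HasDerivAt X (U (X t)) t) ∧ Tendsto X atBot (𝓝 (-r)) ∧ Tendsto X atTop (𝓝 r) := by
  have h0 : (0 : ℝ) ∈ Set.Ioo (-r) r := ⟨by linarith, hr⟩
  have hinv : ContinuousOn (fun x => (U x)⁻¹) (Set.Ioo (-r) r) :=
    hU.inv₀ fun x hx => (hpos x hx).ne'
  set T : ℝ → ℝ := fun x => ∫ ξ in (0 : ℝ)..x, (U ξ)⁻¹ with hT
  have hTd : ∀ x ∈ Set.Ioo (-r) r, HasDerivAt T (U x)⁻¹ x := by
    intro x hx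
    have hn : Set.Ioo (-r) r ∈ 𝓝 x := isOpen_Ioo.mem_nhds hx
    exact intervalIntegral.integral_hasDerivAt_right
      ((hinv.mono (Set.ordConnected_Ioo.uIcc_subset h0 hx)).intervalIntegrable)
      (hinv.stronglyMeasurableAtFilter isOpen_Ioo x hx) (hinv.continuousAt hn)
  have hTc : ContinuousOn T (Set.Ioo (-r) r) := fun x hx =>
    (hTd x hx).continuousAt.continuousWithinAt
  have hTm : StrictMonoOn T (Set.Ioo (-r) r) :=
    strictMonoOn_of_deriv_pos (convex_Ioo _ _) hTc fun x hx => by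
      rw [interior_Ioo] at hx
      rw [(hTd x hx).deriv]
      exact inv_pos.2 (hpos x hx)
  -- The travel time for the majorant `C (r² - x²)`. As `T - A` is monotone, `T` inherits the
  -- logarithmic divergence of `A` at both ends.
  set A : ℝ → ℝ := fun x => (2 * C * r)⁻¹ * (Real.log (r + x) - Real.log (r - x)) with hA
  have hAd : ∀ x ∈ Set.Ioo (-r) r, HasDerivAt A (C * (r ^ 2 - x ^ 2))⁻¹ x := by
    intro x hx
    have h1 : r + x ≠ 0 := by linarith [hx.1]
    have h2 : r - x ≠ 0 := by linarith [hx.2]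
    have h3 := (((hasDerivAt_id x).const_add r).log h1).sub (((hasDerivAt_id x).const_sub r).log h2)
    convert! h3.const_mul (2 * C * r)⁻¹ using 1
    have h4 : r ^ 2 - x ^ 2 = (r + x) * (r - x) := by ring
    simp only [id, h4]
    field_simp
    ring
  have hmono : MonotoneOn (T - A) (Set.Ioo (-r) r) := by
    refine monotoneOn_of_deriv_nonneg (convex_Ioo _ _)
      (fun x hx => ((hTd x hx).sub (hAd x hx)).continuousAt.continuousWithinAt)
      (fun x hx => ?_) fun x hx => ?_
    · rw [interior_Ioo] at hx
      exact ((hTd x hx).sub (hAd x hx)).differentiableAt.differentiableWithinAt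
    · rw [interior_Ioo] at hx
      rw [((hTd x hx).sub (hAd x hx)).deriv, sub_nonneg]
      exact inv_anti₀ (hpos x hx) (hle x hx)
  have hTA0 : T 0 - A 0 = 0 := by simp [hT, hA]
  have hsurj : ∀ t, t ∈ T '' Set.Ioo (-r) r := by
    intro t
    set m := 2 * C * r * |t| with hm
    have hm0 : 0 ≤ m := by positivity
    -- Chosen so that `log (r - x) = log r - m`, which makes `A x ≥ |t|`.
    set x := r * (1 - Real.exp (-m)) with hx
    have he : 0 < Real.exp (-m) := Real.exp_pos _
    have he1 : Real.exp (-m) ≤ 1 := Real.exp_le_one_iff.2 (by linarith)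
    have hx0 : 0 ≤ x := mul_nonneg hr.le (by linarith)
    have hxr : x < r := by nlinarith
    have hxm : x ∈ Set.Ioo (-r) r := ⟨by linarith, hxr⟩
    have hxm' : -x ∈ Set.Ioo (-r) r := ⟨by linarith, by linarith⟩
    have h1 : Real.log (r - x) = Real.log r - m := by
      rw [show r - x = r * Real.exp (-m) by rw [hx]; ring, Real.log_mul hr.ne' he.ne', Real.log_exp]
      ring
    have h2 : Real.log r ≤ Real.log (r + x) := Real.log_le_log hr (by linarith)
    have h3 : |t| = (2 * C * r)⁻¹ * m := by rw [hm]; field_simp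
    have h4 : |t| ≤ A x := by
      rw [h3]
      simp only [hA]
      gcongr
      linarith
    have h5 : A (-x) = -A x := by
      simp only [hA, sub_neg_eq_add, ← sub_eq_add_neg]
      ring
    have h6 : T 0 - A 0 ≤ T x - A x := hmono h0 hxm hx0
    have h7 : T (-x) - A (-x) ≤ T 0 - A 0 := hmono hxm' h0 (by linarith)
    obtain ⟨z, hz, rfl⟩ := intermediate_value_Icc (by linarith : -x ≤ x)
      (hTc.mono fun y hy => ⟨hxm'.1.trans_le hy.1, hy.2.trans_lt hxm.2⟩)
      (show t ∈ Set.Icc (T (-x)) (T x) from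
        ⟨by linarith [neg_abs_le t], by linarith [le_abs_self t]⟩)
    exact ⟨z, ⟨hxm'.1.trans_le hz.1, hz.2.trans_lt hxm.2⟩, rfl⟩
  obtain ⟨X, hXc, hX⟩ := exists_continuous_inverse Set.ordConnected_Ioo hTc hTm
  rw [Set.eq_univ_of_forall hsurj, continuousOn_univ] at hXc
  have hXmem : ∀ t, X t ∈ Set.Ioo (-r) r ∧ T (X t) = t := by
    intro t
    obtain ⟨z, hz, rfl⟩ := hsurj t
    rw [hX z hz]
    exact ⟨hz, rfl⟩
  refine ⟨X, fun t => (hXmem t).1, fun z hz => ⟨T z, hX z hz⟩, fun t => ?_, ?_, ?_⟩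
  · have := HasDerivAt.of_local_left_inverse hXc.continuousAt (hTd _ (hXmem t).1)
      (inv_pos.2 (hpos _ (hXmem t).1)).ne' (Eventually.of_forall fun s => (hXmem s).2)
    rwa [inv_inv] at this
  · refine tendsto_order.2 ⟨fun a ha => Eventually.of_forall fun t => ha.trans (hXmem t).1.1,
      fun a ha => ?_⟩
    obtain ⟨z, hz1, hz2⟩ := exists_between (lt_min ha (by linarith : -r < r))
    have hz : z ∈ Set.Ioo (-r) r := ⟨hz1, hz2.trans_le (min_le_right _ _)⟩
    filter_upwards [eventually_le_atBot (T z)] with t ht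
    have : X t ≤ z := (hTm.le_iff_le (hXmem t).1 hz).1 ((hXmem t).2.trans_le ht)
    exact this.trans_lt (hz2.trans_le (min_le_left _ _))
  · refine tendsto_order.2 ⟨fun a ha => ?_,
      fun a ha => Eventually.of_forall fun t => (hXmem t).1.2.trans ha⟩
    obtain ⟨z, hz1, hz2⟩ := exists_between (max_lt ha (by linarith : -r < r))
    have hz : z ∈ Set.Ioo (-r) r := ⟨(le_max_right _ _).trans_lt hz1, hz2⟩
    filter_upwards [eventually_ge_atTop (T z)] with t ht
    have : z ≤ X t := (hTm.le_iff_le hz (hXmem t).1).1 (ht.trans_eq (hXmem t).2.symm)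
    exact ((le_max_left _ _).trans_lt hz1).trans_le this

/-- A graph that satisfies the energy balance carries a connection. -/
theorem exists_connection_of_graph {r C : ℝ} (hr : 0 < r) (hC : 0 < C) {G : ℝ × ℝ → ℝ}
    {U : ℝ → ℝ} (hpos : ∀ x ∈ Set.Ioo (-r) r, 0 < U x)
    (hle : ∀ x ∈ Set.Ioo (-r) r, U x ≤ C * (r ^ 2 - x ^ 2))
    (hd : ∀ x ∈ Set.Ioo (-r) r,
      HasDerivAt (fun x => U x ^ 2) (2 * (-x + x ^ 3 / r ^ 2) + 2 * (G (x, U x) * U x)) x) :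
    ∃ γ : ℝ → ℝ × ℝ, IsConnection (dampedField r G) (-r, 0) (r, 0) γ ∧
      Set.range γ = {p | p.1 ∈ Set.Ioo (-r) r ∧ p.2 = U p.1} := by
  have hUd : ∀ x ∈ Set.Ioo (-r) r,
      HasDerivAt U ((-x + x ^ 3 / r ^ 2 + G (x, U x) * U x) / U x) x := by
    intro x hx
    have h1 := (hd x hx).sqrt (pow_pos (hpos x hx) 2).ne'
    rw [Real.sqrt_sq (hpos x hx).le] at h1
    have h2 : HasDerivAt U ((2 * (-x + x ^ 3 / r ^ 2) + 2 * (G (x, U x) * U x)) / (2 * U x)) x := by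
      refine h1.congr_of_eventuallyEq ?_
      filter_upwards [isOpen_Ioo.mem_nhds hx] with z hz
      exact (Real.sqrt_sq (hpos z hz).le).symm
    convert! h2 using 1
    have := (hpos x hx).ne'
    field_simp
  obtain ⟨X, hX, hXs, hXd, hbot, htop⟩ := exists_time_parametrization hr hC
    (fun x hx => (hUd x hx).continuousAt.continuousWithinAt) hpos hle
  have hlim : ∀ {l : Filter ℝ} {c : ℝ}, c ^ 2 = r ^ 2 → Tendsto X l (𝓝 c) →
      Tendsto (fun t => U (X t)) l (𝓝 0) := by
    intro l c hc hl
    refine squeeze_zero (fun t => (hpos _ (hX t)).le) (fun t => hle _ (hX t)) ?_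
    have := ((hl.pow 2).const_sub (r ^ 2)).const_mul C
    simpa [hc] using this
  refine ⟨fun t => (X t, U (X t)), ⟨fun t => ?_, ?_, ?_⟩, ?_⟩
  · have h1 := (hUd _ (hX t)).comp t (hXd t)
    convert! (hXd t).prodMk h1 using 1
    have := (hpos _ (hX t)).ne'
    ext
    · rfl
    · simp only [dampedField]
      field_simp
  · exact hbot.prodMk_nhds (hlim (by ring) hbot)
  · exact htop.prodMk_nhds (hlim rfl htop)
  · ext p
    constructor
    · rintro ⟨t, rfl⟩
      exact ⟨hX t, rfl⟩
    · rintro ⟨h1, h2⟩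
      obtain ⟨t, ht⟩ := hXs _ h1
      exact ⟨t, Prod.ext ht (by simp only; rw [ht, h2])⟩

/-! ### Parameters of the canonical form and the Melnikov integral -/

section Parameters

variable {a b : ℝ}

/-- The curvature constant `√(-b / a²)` of the unperturbed arc. -/
noncomputable def arcCurvature (a b : ℝ) : ℝ := √(-b / a ^ 2)

theorem saddleX_pos (ha : 0 < a) (hb : b < 0) : 0 < saddleX a b :=
  div_pos ha (Real.sqrt_pos.2 (by linarith))

theorem arcCurvature_pos (ha : 0 < a) (hb : b < 0) : 0 < arcCurvature a b :=
  Real.sqrt_pos.2 (div_pos (by linarith) (by positivity))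

theorem saddleX_sq (hb : b < 0) : saddleX a b ^ 2 = a ^ 2 / (-(2 * b)) := by
  rw [saddleX, div_pow, Real.sq_sqrt (by linarith)]

theorem arcCurvature_sq (hb : b < 0) : arcCurvature a b ^ 2 = -b / a ^ 2 :=
  Real.sq_sqrt (div_nonneg (by linarith) (sq_nonneg a))

theorem curvature_saddle (ha : 0 < a) (hb : b < 0) :
    2 * arcCurvature a b ^ 2 * saddleX a b ^ 2 = 1 := by
  rw [saddleX_sq hb, arcCurvature_sq hb]
  have := hb.ne
  field_simp

theorem arcHeight_eq (ha : 0 < a) (hb : b < 0) (x : ℝ) :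
    arcHeight a b x = arcProfile (arcCurvature a b) (saddleX a b) x := by
  have h : √(a ^ 2 / (-(4 * b))) = arcCurvature a b * saddleX a b ^ 2 := by
    rw [Real.sqrt_eq_iff_mul_self_eq (div_nonneg (sq_nonneg a) (by linarith))
      (mul_nonneg (arcCurvature_pos ha hb).le (sq_nonneg _)), ← sq, mul_pow, arcCurvature_sq hb,
      saddleX_sq hb]
    have := hb.ne
    field_simp
    norm_num
  rw [arcHeight, h, arcProfile]
  change -arcCurvature a b * x ^ 2 + _ = _
  ring

theorem melnikov_integral (κ r d1 d2 d3 d4 d5 d6 : ℝ) :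
    ∫ x in (-r)..r, perturbQ d1 d2 d3 d4 d5 d6 x (arcProfile κ r x) =
      κ * (4 * d3 * r ^ 3 / 3 + 4 * d2 * r ^ 5 / 15 + 4 * d1 * r ^ 7 / 35 + 4 * d5 * r ^ 9 / 63)
        + 32 * κ ^ 3 * d4 * r ^ 7 / 35 + 512 * κ ^ 5 * d6 * r ^ 11 / 693 := by
  -- An explicit antiderivative, obtained by expanding the powers of `r² - x²`.
  set F : ℝ → ℝ := fun x =>
    κ * (d3 * (r ^ 2 * x - x ^ 3 / 3) + d2 * (r ^ 2 * x ^ 3 / 3 - x ^ 5 / 5)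
      + d1 * (r ^ 2 * x ^ 5 / 5 - x ^ 7 / 7) + d5 * (r ^ 2 * x ^ 7 / 7 - x ^ 9 / 9))
      + κ ^ 3 * d4 * (r ^ 6 * x - r ^ 4 * x ^ 3 + 3 * r ^ 2 * x ^ 5 / 5 - x ^ 7 / 7)
      + κ ^ 5 * d6 * (r ^ 10 * x - 5 * r ^ 8 * x ^ 3 / 3 + 2 * r ^ 6 * x ^ 5
        - 10 * r ^ 4 * x ^ 7 / 7 + 5 * r ^ 2 * x ^ 9 / 9 - x ^ 11 / 11) with hF
  have hd : ∀ x, HasDerivAt F (perturbQ d1 d2 d3 d4 d5 d6 x (arcProfile κ r x)) x := by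
    intro x
    have hdiff : DifferentiableAt ℝ F x := by simp only [hF]; fun_prop
    convert! hdiff.hasDerivAt using 1
    have hp : ∀ n : ℕ, HasDerivAt (fun x : ℝ => x ^ n) (n * x ^ (n - 1)) x := fun n =>
      hasDerivAt_pow n x
    have h1 := hasDerivAt_id' x
    have := ((((((h1.const_mul (r ^ 2)).sub ((hp 3).div_const 3)).const_mul d3).add
      ((((hp 3).const_mul (r ^ 2)).div_const 3 |>.sub ((hp 5).div_const 5)).const_mul d2)).add
      ((((hp 5).const_mul (r ^ 2)).div_const 5 |>.sub ((hp 7).div_const 7)).const_mul d1)).add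
      ((((hp 7).const_mul (r ^ 2)).div_const 7 |>.sub ((hp 9).div_const 9)).const_mul d5)).const_mul κ
    have h4 := ((((h1.const_mul (r ^ 6)).sub ((hp 3).const_mul (r ^ 4))).add
      (((hp 5).const_mul (3 * r ^ 2)).div_const 5)).sub ((hp 7).div_const 7)).const_mul (κ ^ 3 * d4)
    have h6 := ((((((h1.const_mul (r ^ 10)).sub (((hp 3).const_mul (5 * r ^ 8)).div_const 3)).add
      ((hp 5).const_mul (2 * r ^ 6))).sub (((hp 7).const_mul (10 * r ^ 4)).div_const 7)).add
      (((hp 9).const_mul (5 * r ^ 2)).div_const 9)).sub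
      ((hp 11).div_const 11)).const_mul (κ ^ 5 * d6)
    have htot := (this.add h4).add h6
    refine Eq.trans ?_ (htot.deriv).symm
    simp only [perturbQ, arcProfile]
    push_cast
    ring
  rw [intervalIntegral.integral_eq_sub_of_hasDerivAt (fun x _ => hd x)
    ((by unfold perturbQ arcProfile; fun_prop : Continuous _).intervalIntegrable _ _)]
  simp only [hF]
  ring

theorem melnikovOne_eq (ha : 0 < a) (hb : b < 0) (d1 d2 d3 d4 d5 d6 : ℝ) :
    melnikovOne a b d1 d2 d3 d4 d5 d6 =
      1 / (13860 * √2 * b ^ 4) *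
        (-(198 * a ^ 6 * b * d1) + 924 * a ^ 4 * b ^ 2 * d2 - 9240 * a ^ 2 * b ^ 3 * d3
          + 1584 * a ^ 4 * b ^ 2 * d4 + 55 * a ^ 8 * d5 - 320 * a ^ 6 * b * d6) := by
  unfold melnikovOne
  simp only [arcHeight_eq ha hb]
  rw [melnikov_integral]
  set κ := arcCurvature a b
  set r := saddleX a b
  have hκ : 0 < κ := arcCurvature_pos ha hb
  have hr : 0 < r := saddleX_pos ha hb
  have hq : 0 < √(2 : ℝ) := by positivity
  -- This relation eliminates `b` and `r` in favour of `a`, `κ` and `√2`; afterwards only `q² = 2`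
  -- is needed of `q = √2`.
  have h1 : √2 * κ * r = 1 := by
    have h2 : (√2 * κ * r) ^ 2 = 1 := by
      rw [mul_pow, mul_pow, Real.sq_sqrt zero_le_two]
      exact curvature_saddle ha hb
    exact (pow_eq_one_iff_of_nonneg (by positivity) two_ne_zero).1 h2
  have h3 : b = -(a ^ 2 * κ ^ 2) := by
    rw [arcCurvature_sq hb]; field_simp
  have h4 : r = √2 / (2 * κ) := by
    rw [eq_div_iff (by positivity)]
    have := Real.sq_sqrt (zero_le_two (α := ℝ))
    nlinarith
  have h5 : √(2 : ℝ) ^ 2 = 2 := Real.sq_sqrt zero_le_two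
  rw [h3, h4]
  generalize √(2 : ℝ) = q at *
  have e3 : q ^ 3 = 2 * q := by rw [pow_succ, h5]
  have e5 : q ^ 5 = 4 * q := by rw [show q ^ 5 = (q ^ 2) ^ 2 * q by ring, h5]; ring
  have e7 : q ^ 7 = 8 * q := by rw [show q ^ 7 = (q ^ 2) ^ 3 * q by ring, h5]; ring
  have e9 : q ^ 9 = 16 * q := by rw [show q ^ 9 = (q ^ 2) ^ 4 * q by ring, h5]; ring
  have e11 : q ^ 11 = 32 * q := by rw [show q ^ 11 = (q ^ 2) ^ 5 * q by ring, h5]; ring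
  have ei : 1 / (13860 * q * (-(a ^ 2 * κ ^ 2)) ^ 4) =
      q / (2 * 13860 * (a ^ 2 * κ ^ 2) ^ 4) := by
    rw [show (-(a ^ 2 * κ ^ 2)) ^ 4 = (a ^ 2 * κ ^ 2) ^ 4 by ring]
    rw [div_eq_div_iff (by positivity) (by positivity)]
    linear_combination (-13860 * (a ^ 2 * κ ^ 2) ^ 4) * h5
  rw [ei]
  simp only [div_pow, e3, e5, e7, e9, e11]
  field_simp
  ring

/-- The integral is affine in `d2` with nonzero slope, and `phiLead` is its zero. -/
theorem melnikovOne_eq_zero_iff (ha : 0 < a) (hb : b < 0) (d1 d2 d3 d4 d5 d6 : ℝ) :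
    melnikovOne a b d1 d2 d3 d4 d5 d6 = 0 ↔ d2 = phiLead a b d1 d3 d4 d5 d6 := by
  have hb' := hb.ne
  have e : melnikovOne a b d1 d2 d3 d4 d5 d6 =
      924 * a ^ 4 * b ^ 2 / (13860 * √2 * b ^ 4) * (d2 - phiLead a b d1 d3 d4 d5 d6) := by
    rw [melnikovOne_eq ha hb]
    unfold phiLead
    field_simp
    ring
  have hne : 924 * a ^ 4 * b ^ 2 / (13860 * √2 * b ^ 4) ≠ 0 := by positivity
  rw [e, mul_eq_zero, or_iff_right hne, sub_eq_zero]

end Parameters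

/-! ### The perturbation along profiles -/

/-- The factor of `y` in the perturbation. -/
def perturbFactor (d1 d2 d3 d4 d5 d6 : ℝ) (p : ℝ × ℝ) : ℝ :=
  d3 + d2 * p.1 ^ 2 + d1 * p.1 ^ 4 + d4 * p.2 ^ 2 + d5 * p.1 ^ 6 + d6 * p.2 ^ 4

/-- The perturbation without its `x²`-term along the graph of `σ · arcProfile`, divided by
`arcProfile`. -/
def perturbReaction (κ r d1 d3 d4 d5 d6 : ℝ) (ξ σ : ℝ) : ℝ :=
  (d3 + d1 * ξ ^ 4 + d4 * (arcProfile κ r ξ * σ) ^ 2 + d5 * ξ ^ 6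
    + d6 * (arcProfile κ r ξ * σ) ^ 4) * σ

section

variable {a b d1 d2 d3 d4 d5 d6 ε κ r R : ℝ}

theorem canonicalField_eq (ha : 0 < a) (hb : b < 0) :
    canonicalField a b ε d1 d2 d3 d4 d5 d6 =
      dampedField (saddleX a b) fun p => ε * perturbFactor d1 d2 d3 d4 d5 d6 p := by
  ext1 p
  have := hb.ne
  simp only [canonicalField, dampedField, perturbQ, perturbFactor, saddleX_sq hb]
  ext
  · rfl
  · simp only
    field_simp
    ring

theorem contDiff_perturbFactor :
    ContDiff ℝ 1 fun p => ε * perturbFactor d1 d2 d3 d4 d5 d6 p := by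
  unfold perturbFactor
  fun_prop

theorem canonicalField_neg (p : ℝ × ℝ) :
    canonicalField a b ε d1 d2 d3 d4 d5 d6 (-p) = -canonicalField a b ε d1 d2 d3 d4 d5 d6 p := by
  ext
  · simp [canonicalField]
  · simp only [canonicalField, perturbQ, Prod.fst_neg, Prod.snd_neg]
    ring

/-- Only the powers `σ`, `σ³`, `σ⁵` occur. On `[1/2, 2]` the Lipschitz constant of `σ⁵` is at most
`80 = 5 · 2⁴`, which also dominates the other bounds. -/
theorem isReaction_perturbReaction (hr : 0 < r) (hκ : 0 < κ) (h1 : |d1| ≤ R) (h3 : |d3| ≤ R)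
    (h4 : |d4| ≤ R) (h5 : |d5| ≤ R) (h6 : |d6| ≤ R) :
    IsReaction r (R * (80 * (1 + r ^ 4 + r ^ 6 + (κ * r ^ 2) ^ 2 + (κ * r ^ 2) ^ 4)))
      (perturbReaction κ r d1 d3 d4 d5 d6) := by
  have hR : 0 ≤ R := (abs_nonneg _).trans h1
  have hxr : ∀ x ∈ Set.Ioo (-r) r, |x| ≤ r := fun x hx => abs_le.2 ⟨hx.1.le, hx.2.le⟩
  have hA : ∀ x ∈ Set.Ioo (-r) r,
      |d3 + d1 * x ^ 4 + d5 * x ^ 6| ≤ R * (1 + r ^ 4 + r ^ 6) := by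
    intro x hx
    have := hxr x hx
    calc _ ≤ |d3| + |d1 * x ^ 4| + |d5 * x ^ 6| := abs_add_three _ _ _
      _ ≤ R + R * r ^ 4 + R * r ^ 6 := by
          rw [abs_mul, abs_mul, abs_pow, abs_pow]
          gcongr
      _ = _ := by ring
  have hy : ∀ x ∈ Set.Ioo (-r) r, |arcProfile κ r x| ≤ κ * r ^ 2 := fun x hx => by
    rw [abs_of_pos (arcProfile_pos hκ hx)]
    exact arcProfile_le hκ x
  have hB : ∀ x ∈ Set.Ioo (-r) r, |d4 * arcProfile κ r x ^ 2| ≤ R * (κ * r ^ 2) ^ 2 := by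
    intro x hx
    have := hy x hx
    rw [abs_mul, abs_pow]
    gcongr
  have hC : ∀ x ∈ Set.Ioo (-r) r, |d6 * arcProfile κ r x ^ 4| ≤ R * (κ * r ^ 2) ^ 4 := by
    intro x hx
    have := hy x hx
    rw [abs_mul, abs_pow]
    gcongr
  have key : ∀ x ∈ Set.Ioo (-r) r, ∀ u v w t : ℝ, 0 ≤ t → |u| ≤ 80 * t → |v| ≤ 80 * t →
      |w| ≤ 80 * t → |(d3 + d1 * x ^ 4 + d5 * x ^ 6) * u + (d4 * arcProfile κ r x ^ 2) * v
        + (d6 * arcProfile κ r x ^ 4) * w| ≤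
        R * (80 * (1 + r ^ 4 + r ^ 6 + (κ * r ^ 2) ^ 2 + (κ * r ^ 2) ^ 4)) * t := by
    intro x hx u v w t ht hu hv hw
    calc _ ≤ _ := abs_add_three _ _ _
      _ ≤ R * (1 + r ^ 4 + r ^ 6) * (80 * t) + R * (κ * r ^ 2) ^ 2 * (80 * t)
          + R * (κ * r ^ 2) ^ 4 * (80 * t) := by
          rw [abs_mul (_ + _), abs_mul (d4 * _), abs_mul (d6 * _)]
          gcongr
          · exact hA x hx
          · exact hB x hx
          · exact hC x hx
      _ = _ := by ring
  have e : ∀ x σ : ℝ, perturbReaction κ r d1 d3 d4 d5 d6 x σ =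
      (d3 + d1 * x ^ 4 + d5 * x ^ 6) * σ + (d4 * arcProfile κ r x ^ 2) * σ ^ 3
        + (d6 * arcProfile κ r x ^ 4) * σ ^ 5 := fun x σ => by
    unfold perturbReaction
    ring
  refine ⟨?_, fun x hx σ hσ => ?_, fun x hx σ hσ σ' hσ' => ?_⟩
  · unfold perturbReaction arcProfile
    fun_prop
  · rw [e, ← mul_one (R * _)]
    have h0 : 0 ≤ σ := by linarith [hσ.1]
    refine key x hx _ _ _ 1 zero_le_one ?_ ?_ ?_
    · rw [abs_of_nonneg h0]; linarith [hσ.2]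
    · rw [abs_of_nonneg (by positivity)]
      calc σ ^ 3 ≤ 2 ^ 3 := by gcongr; exact hσ.2
        _ ≤ _ := by norm_num
    · rw [abs_of_nonneg (by positivity)]
      calc σ ^ 5 ≤ 2 ^ 5 := by gcongr; exact hσ.2
        _ ≤ _ := by norm_num
  · have h0 : 0 ≤ σ := by linarith [hσ.1]
    have h0' : 0 ≤ σ' := by linarith [hσ'.1]
    have s2 := hσ.2
    have s2' := hσ'.2
    have e' : perturbReaction κ r d1 d3 d4 d5 d6 x σ - perturbReaction κ r d1 d3 d4 d5 d6 x σ' =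
        (d3 + d1 * x ^ 4 + d5 * x ^ 6) * (σ - σ') + (d4 * arcProfile κ r x ^ 2) * (σ ^ 3 - σ' ^ 3)
          + (d6 * arcProfile κ r x ^ 4) * (σ ^ 5 - σ' ^ 5) := by
      rw [e, e]
      ring
    rw [e']
    refine key x hx _ _ _ _ (abs_nonneg _) ?_ ?_ ?_
    · linarith [abs_nonneg (σ - σ')]
    · rw [show σ ^ 3 - σ' ^ 3 = (σ ^ 2 + σ * σ' + σ' ^ 2) * (σ - σ') by ring, abs_mul,
        abs_of_nonneg (by positivity)]
      gcongr
      calc σ ^ 2 + σ * σ' + σ' ^ 2 ≤ 2 ^ 2 + 2 * 2 + 2 ^ 2 := by gcongr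
        _ ≤ 80 := by norm_num
    · rw [show σ ^ 5 - σ' ^ 5 = (σ ^ 4 + σ ^ 3 * σ' + σ ^ 2 * σ' ^ 2 + σ * σ' ^ 3 + σ' ^ 4)
        * (σ - σ') by ring, abs_mul, abs_of_nonneg (by positivity)]
      gcongr
      calc σ ^ 4 + σ ^ 3 * σ' + σ ^ 2 * σ' ^ 2 + σ * σ' ^ 3 + σ' ^ 4
          ≤ 2 ^ 4 + 2 ^ 3 * 2 + 2 ^ 2 * 2 ^ 2 + 2 * 2 ^ 3 + 2 ^ 4 := by gcongr
        _ ≤ 80 := by norm_num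

/-- For `S = 1` the total energy gain is the Melnikov integral along the unperturbed arc. -/
theorem balanceCoeff_one (ha : 0 < a) (hb : b < 0) :
    balanceCoeff (arcCurvature a b) (saddleX a b)
      (perturbReaction (arcCurvature a b) (saddleX a b) d1 d3 d4 d5 d6) (fun _ => 1) =
      phiLead a b d1 d3 d4 d5 d6 := by
  have hκ := arcCurvature_pos ha hb
  have hr := saddleX_pos ha hb
  have hw := weightIntegral_pos hκ hr isProfile_one
  have h := (melnikovOne_eq_zero_iff ha hb d1 _ d3 d4 d5 d6).2 rfl
  set φ := phiLead a b d1 d3 d4 d5 d6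
  set κ := arcCurvature a b
  set r := saddleX a b
  have h2 : reactionIntegral κ r (perturbReaction κ r d1 d3 d4 d5 d6) (fun _ => 1)
      + φ * weightIntegral κ r (fun _ => 1) = 0 := by
    rw [← h]
    unfold reactionIntegral weightIntegral melnikovOne
    rw [← intervalIntegral.integral_const_mul, ← intervalIntegral.integral_add
      ((by unfold perturbReaction arcProfile; fun_prop : Continuous _).intervalIntegrable _ _)
      ((by unfold arcProfile; fun_prop : Continuous _).intervalIntegrable _ _)]
    refine intervalIntegral.integral_congr fun x _ => ?_
    simp only [arcHeight_eq ha hb, perturbReaction, perturbQ]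
    ring
  rw [balanceCoeff, div_eq_iff hw.ne']
  linarith

theorem perturbFactor_mul (x s : ℝ) :
    ε * perturbFactor d1 d2 d3 d4 d5 d6 (x, arcProfile κ r x * s) * (arcProfile κ r x * s) =
      ε * ((perturbReaction κ r d1 d3 d4 d5 d6 x s + d2 * (x ^ 2 * s)) * arcProfile κ r x) := by
  simp only [perturbFactor, perturbReaction]
  ring

/-- The profile of a graph that satisfies the energy balance is a fixed point. -/
theorem exists_profile_of_connection {M F : ℝ} (hr : 0 < r) (hκ0 : 0 < κ)
    (hκ : 2 * κ ^ 2 * r ^ 2 = 1) (hn : IsReaction r M (perturbReaction κ r d1 d3 d4 d5 d6))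
    (hε : ε ≠ 0) {γ : ℝ → ℝ × ℝ}
    (h : IsConnection (dampedField r fun p => ε * perturbFactor d1 d2 d3 d4 d5 d6 p)
      (-r, 0) (r, 0) γ)
    (hb : ∀ t, |ε * perturbFactor d1 d2 d3 d4 d5 d6 (γ t)| ≤ F) (hF : F ≤ 1 / 2)
    (hFC : F * ((4 + 4 * κ * r) / (κ * r) ^ 2) ≤ 3 / 4) :
    ∃ S, IsBalancedProfile κ r ε (perturbReaction κ r d1 d3 d4 d5 d6) S ∧
      d2 = balanceCoeff κ r (perturbReaction κ r d1 d3 d4 d5 d6) S := by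
  have hG := contDiff_perturbFactor (d1 := d1) (d2 := d2) (d3 := d3) (d4 := d4) (d5 := d5)
    (d6 := d6) (ε := ε)
  have hr' : -r ≤ r := by linarith
  obtain ⟨U, hUc, hUl, hUr, hU⟩ := h.exists_graph hr hG fun t => (hb t).trans hF
  set n := perturbReaction κ r d1 d3 d4 d5 d6
  have hsq := fun x hx => graph_sq_eq (x := x) hr hκ hG.continuous hUc hUl (fun x hx => (hU x hx).2.2) hx
  have hAr : arcProfile κ r r = 0 := by simp [arcProfile]
  have hAl : arcProfile κ r (-r) = 0 := by simp [arcProfile]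
  have htot : ∫ ξ in (-r)..r, ε * perturbFactor d1 d2 d3 d4 d5 d6 (ξ, U ξ) * U ξ = 0 := by
    have := hsq r ⟨hr', le_rfl⟩
    rw [hUr, hAr] at this
    linarith
  have hU0 : ∀ x ∈ Set.Icc (-r) r, 0 ≤ U x := by
    intro x hx
    rcases hx.1.eq_or_lt with rfl | h1
    · exact hUl.ge
    rcases hx.2.eq_or_lt with rfl | h2
    · exact hUr.ge
    exact (hU x ⟨h1, h2⟩).1.le
  have hbd := fun x hx => graph_bound (x := x) (F := F) hr hκ0 (by linarith) hUc
    (h := fun ξ => ε * perturbFactor d1 d2 d3 d4 d5 d6 (ξ, U ξ))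
    (hG.continuous.comp_continuousOn (continuousOn_id.prodMk hUc)) hU0
    (fun x hx => by
      obtain ⟨t, ht⟩ := (hU x hx).2.1
      simpa only [ht] using hb t) hsq htot hx
  set S : ℝ → ℝ := fun x => U x / arcProfile κ r x with hSdef
  have hUS : ∀ x ∈ Set.Icc (-r) r, U x = arcProfile κ r x * S x := by
    intro x hx
    rcases hx.1.eq_or_lt with rfl | h1
    · rw [hUl, hAl, zero_mul]
    rcases hx.2.eq_or_lt with rfl | h2
    · rw [hUr, hAr, zero_mul]
    have := (arcProfile_pos hκ0 ⟨h1, h2⟩).ne'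
    simp only [hSdef]
    field_simp
  have hS : IsProfile r S := by
    constructor
    · exact (hUc.mono Set.Ioo_subset_Icc_self).div continuous_arcProfile.continuousOn
        fun x hx => (arcProfile_pos hκ0 hx).ne'
    · intro x hx
      have hA := arcProfile_pos hκ0 hx
      have hx' := Set.Ioo_subset_Icc_self hx
      have hA2 := pow_pos hA 2
      -- This says `U² / arcProfile² ∈ [1/4, 7/4]`, so `S` lies in `[1/2, 2]`.
      have h1 := abs_le.1 ((hbd x hx').trans (mul_le_mul_of_nonneg_right hFC hA2.le))
      have h2 := hU0 x hx'
      constructor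
      · rw [le_div_iff₀ hA]
        nlinarith
      · rw [div_le_iff₀ hA]
        nlinarith
  have hint : ∀ x ∈ Set.Icc (-r) r,
      ∫ ξ in (-r)..x, ε * perturbFactor d1 d2 d3 d4 d5 d6 (ξ, U ξ) * U ξ =
        ε * ∫ ξ in (-r)..x, (n ξ (S ξ) + d2 * (ξ ^ 2 * S ξ)) * arcProfile κ r ξ := by
    intro x hx
    rw [← intervalIntegral.integral_const_mul]
    refine intervalIntegral.integral_congr fun ξ hξ => ?_
    rw [Set.uIcc_of_le hx.1] at hξ
    rw [hUS ξ ⟨hξ.1, hξ.2.trans hx.2⟩]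
    exact perturbFactor_mul ξ (S ξ)
  have hd2 : d2 = balanceCoeff κ r n S := by
    have h1 := (hint r ⟨hr', le_rfl⟩).symm.trans htot
    -- Here `ε ≠ 0` is essential: for `ε = 0` the balance imposes no condition on `d2`.
    have h2 := (mul_eq_zero.1 h1).resolve_left hε
    simp only [add_mul, mul_assoc d2] at h2
    rw [intervalIntegral.integral_add
      (intervalIntegrable_mul_arcProfile (hn.continuousOn hS)
        (fun x hx => hn.bound x hx _ (hS.2 x hx)) ⟨le_rfl, hr'⟩ ⟨hr', le_rfl⟩)
      ((intervalIntegrable_mul_arcProfile hS.continuousOn_weight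
        (fun x hx => hS.abs_weight_le hx) ⟨le_rfl, hr'⟩ ⟨hr', le_rfl⟩).const_mul _),
      intervalIntegral.integral_const_mul] at h2
    change reactionIntegral κ r n S + d2 * weightIntegral κ r S = 0 at h2
    rw [balanceCoeff, eq_div_iff (weightIntegral_pos hκ0 hr hS).ne']
    linarith
  refine ⟨S, ⟨hS, fun x hx => ?_⟩, hd2⟩
  have hA := arcProfile_pos hκ0 hx
  have hx' := Set.Ioo_subset_Icc_self hx
  have h1 := hsq x hx'
  rw [hint x hx', hd2] at h1
  change U x ^ 2 = _ + 2 * (ε * energyGain κ r n S x) at h1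
  have h2 : 1 + 2 * ε * (energyGain κ r n S x / arcProfile κ r x ^ 2) = S x ^ 2 := by
    simp only [hSdef, div_pow, h1]
    field_simp
  rw [profileMap, h2, Real.sqrt_sq (by linarith [(hS.2 x hx).1])]

/-- Squaring the fixed point equation gives the integrated energy balance, and differentiating it
gives the equation of the graph. The bound `S ≤ 2` supplies the linear vanishing at the saddles that
makes the travel time infinite. -/
theorem exists_connection_of_profile {M : ℝ} (hr : 0 < r) (hκ0 : 0 < κ)
    (hκ : 2 * κ ^ 2 * r ^ 2 = 1) (hn : IsReaction r M (perturbReaction κ r d1 d3 d4 d5 d6))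
    (hε : |ε| * (8000 / (κ * r) * M) ≤ 1) {S : ℝ → ℝ}
    (hS : IsBalancedProfile κ r ε (perturbReaction κ r d1 d3 d4 d5 d6) S)
    (hd2 : d2 = balanceCoeff κ r (perturbReaction κ r d1 d3 d4 d5 d6) S) :
    ∃ γ, IsConnection (dampedField r fun p => ε * perturbFactor d1 d2 d3 d4 d5 d6 p)
      (-r, 0) (r, 0) γ ∧
      Set.range γ = {p | p.1 ∈ Set.Ioo (-r) r ∧ p.2 = arcProfile κ r p.1 * S p.1} := by
  have hr' : -r ≤ r := by linarith
  have hS1 := hS.1.2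
  set n := perturbReaction κ r d1 d3 d4 d5 d6
  refine exists_connection_of_graph (C := 2 * κ) hr (by linarith)
    (U := fun x => arcProfile κ r x * S x)
    (fun x hx => mul_pos (arcProfile_pos hκ0 hx) (by linarith [(hS1 x hx).1]))
    (fun x hx => ?_) (fun x hx => ?_)
  · calc arcProfile κ r x * S x ≤ arcProfile κ r x * 2 :=
          mul_le_mul_of_nonneg_left (hS1 x hx).2 (arcProfile_pos hκ0 hx).le
      _ = 2 * κ * (r ^ 2 - x ^ 2) := by unfold arcProfile; ring
  · have hnhds : Set.Ioo (-r) r ∈ 𝓝 x := isOpen_Ioo.mem_nhds hx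
    have hsrc : ContinuousOn (fun ξ => balancedSource κ r n S ξ * arcProfile κ r ξ)
        (Set.Ioo (-r) r) :=
      (continuousOn_balancedSource hn hS.1).mul continuous_arcProfile.continuousOn
    have h1 : HasDerivAt (energyGain κ r n S)
        (balancedSource κ r n S x * arcProfile κ r x) x :=
      intervalIntegral.integral_hasDerivAt_right
        (intervalIntegrable_balancedSource hκ0 hr hn hS.1 ⟨le_rfl, hr'⟩
          (Set.Ioo_subset_Icc_self hx))
        (hsrc.stronglyMeasurableAtFilter isOpen_Ioo x hx) (hsrc.continuousAt hnhds)
    have h2 := (hasDerivAt_arcProfile_sq hr hκ x).add (h1.const_mul (2 * ε))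
    have h3 : HasDerivAt (fun x => (arcProfile κ r x * S x) ^ 2)
        (2 * (-x + x ^ 3 / r ^ 2) + 2 * ε * (balancedSource κ r n S x * arcProfile κ r x)) x := by
      refine h2.congr_of_eventuallyEq ?_
      filter_upwards [hnhds] with z hz
      exact hS.sq_eq hκ0 hr hn hε hz
    convert! h3 using 1
    rw [perturbFactor_mul, hd2, balancedSource]
    ring

end

/-! ### The persistence coefficient and heteroclinic loops -/

/-- The coefficient of `x²` for which the connection persists. -/
noncomputable def persistenceCoeff (a b d1 d3 d4 d5 d6 ε : ℝ) : ℝ :=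
  open Classical in
  if h : ∃ S, IsBalancedProfile (arcCurvature a b) (saddleX a b) ε
      (perturbReaction (arcCurvature a b) (saddleX a b) d1 d3 d4 d5 d6) S then
    balanceCoeff (arcCurvature a b) (saddleX a b)
      (perturbReaction (arcCurvature a b) (saddleX a b) d1 d3 d4 d5 d6) h.choose
  -- A default value, never reached for small `ε`. The choice of profile is immaterial because the
  -- coefficient does not depend on it.
  else 0

section

variable {a b d1 d2 d3 d4 d5 d6 ε R M : ℝ}

theorem persistenceCoeff_eq (ha : 0 < a) (hb : b < 0)
    (hn : IsReaction (saddleX a b) M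
      (perturbReaction (arcCurvature a b) (saddleX a b) d1 d3 d4 d5 d6))
    (hε : |ε| * (8000 / (arcCurvature a b * saddleX a b) * M) ≤ 1) {S : ℝ → ℝ}
    (hS : IsBalancedProfile (arcCurvature a b) (saddleX a b) ε
      (perturbReaction (arcCurvature a b) (saddleX a b) d1 d3 d4 d5 d6) S) :
    persistenceCoeff a b d1 d3 d4 d5 d6 ε = balanceCoeff (arcCurvature a b) (saddleX a b)
      (perturbReaction (arcCurvature a b) (saddleX a b) d1 d3 d4 d5 d6) S := by
  have h : ∃ S, IsBalancedProfile (arcCurvature a b) (saddleX a b) ε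
      (perturbReaction (arcCurvature a b) (saddleX a b) d1 d3 d4 d5 d6) S := ⟨S, hS⟩
  rw [persistenceCoeff, dif_pos h]
  exact h.choose_spec.balanceCoeff_eq (arcCurvature_pos ha hb) (saddleX_pos ha hb) hn hε hS

theorem abs_perturbFactor_le {B : ℝ} (hB : 1 ≤ B) (h1 : |d1| ≤ R) (h2 : |d2| ≤ R) (h3 : |d3| ≤ R)
    (h4 : |d4| ≤ R) (h5 : |d5| ≤ R) (h6 : |d6| ≤ R) {p : ℝ × ℝ} (hx : |p.1| ≤ B)
    (hy : |p.2| ≤ B) : |perturbFactor d1 d2 d3 d4 d5 d6 p| ≤ 6 * R * B ^ 6 := by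
  have hR : 0 ≤ R := (abs_nonneg _).trans h1
  have key : ∀ {d x : ℝ} (k : ℕ), k ≤ 6 → |d| ≤ R → |x| ≤ B → |d * x ^ k| ≤ R * B ^ 6 := by
    intro d x k hk hd hx
    rw [abs_mul, abs_pow]
    calc |d| * |x| ^ k ≤ R * B ^ k := by gcongr
      _ ≤ R * B ^ 6 := by gcongr
  have k3 := key (x := 1) 0 (by norm_num) h3 (by simpa using hB)
  have k2 := key 2 (by norm_num) h2 hx
  have k1 := key 4 (by norm_num) h1 hx
  have k4 := key 2 (by norm_num) h4 hy
  have k5 := key 6 (by norm_num) h5 hx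
  have k6 := key 4 (by norm_num) h6 hy
  rw [pow_zero, mul_one] at k3
  rw [abs_le] at *
  unfold perturbFactor
  constructor <;> linarith [k1.1, k1.2, k2.1, k2.2, k3.1, k3.2, k4.1, k4.2, k5.1, k5.2, k6.1, k6.2]

theorem unperturbedLoop_bound (ha : 0 < a) (hb : b < 0) {p : ℝ × ℝ}
    (hp : p ∈ unperturbedLoop a b) :
    |p.1| ≤ saddleX a b ∧ |p.2| ≤ arcCurvature a b * saddleX a b ^ 2 := by
  have hr := saddleX_pos ha hb
  have hκ := arcCurvature_pos ha hb
  have hY : 0 ≤ arcCurvature a b * saddleX a b ^ 2 := by positivity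
  have harc : ∀ x, |x| < saddleX a b →
      |arcHeight a b x| ≤ arcCurvature a b * saddleX a b ^ 2 := by
    intro x hx
    rw [arcHeight_eq ha hb, abs_of_pos (arcProfile_pos hκ (abs_lt.1 hx))]
    exact arcProfile_le hκ x
  rcases hp with ((rfl | ⟨h1, h2⟩) | rfl) | ⟨h1, h2⟩
  · simp [rightSaddle, abs_of_pos hr, hY]
  · exact ⟨h1.le, h2 ▸ harc _ h1⟩
  · simp [leftSaddle, abs_of_pos hr, hY]
  · refine ⟨h1.le, ?_⟩
    rw [h2, abs_neg]
    exact harc _ h1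

theorem bound_of_mem_thickening (ha : 0 < a) (hb : b < 0) {δ : ℝ} (hδ : δ ≤ 1) {p : ℝ × ℝ}
    (hp : p ∈ Metric.thickening δ (unperturbedLoop a b)) :
    |p.1| ≤ saddleX a b + arcCurvature a b * saddleX a b ^ 2 + 1 ∧
      |p.2| ≤ saddleX a b + arcCurvature a b * saddleX a b ^ 2 + 1 := by
  have hr := saddleX_pos ha hb
  have hκ := arcCurvature_pos ha hb
  have hY : 0 ≤ arcCurvature a b * saddleX a b ^ 2 := by positivity
  obtain ⟨q, hq, hpq⟩ := Metric.mem_thickening_iff.1 hp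
  obtain ⟨h1, h2⟩ := unperturbedLoop_bound ha hb hq
  rw [Prod.dist_eq, max_lt_iff, Real.dist_eq, Real.dist_eq] at hpq
  have h3 := abs_sub_abs_le_abs_sub p.1 q.1
  have h4 := abs_sub_abs_le_abs_sub p.2 q.2
  constructor <;> linarith [hpq.1, hpq.2]

/-- The loop formed by a graph over `(-r, r)`, its image under the rotation by `π` and the two
saddles is close to the unperturbed one. -/
theorem setsClose_of_graph {δ : ℝ} (hδ : 0 < δ) {U : ℝ → ℝ}
    (hU : ∀ x ∈ Set.Ioo (-saddleX a b) (saddleX a b), |U x - arcHeight a b x| < δ)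
    {γ : ℝ → ℝ × ℝ}
    (hγ : Set.range γ = {p | p.1 ∈ Set.Ioo (-saddleX a b) (saddleX a b) ∧ p.2 = U p.1}) :
    SetsClose δ ({rightSaddle a b} ∪ Set.range γ ∪ {leftSaddle a b} ∪ Set.range fun t => -γ t)
      (unperturbedLoop a b) := by
  have heven : ∀ x, arcHeight a b (-x) = arcHeight a b x := fun x => by simp [arcHeight]
  have hself : ∀ {p : ℝ × ℝ} {s : Set (ℝ × ℝ)}, p ∈ s → p ∈ Metric.thickening δ s := fun hp =>
    Metric.self_subset_thickening hδ _ hp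
  constructor
  · rintro p (((rfl | hp) | rfl) | ⟨t, rfl⟩)
    · exact hself (Or.inl (Or.inl (Or.inl rfl)))
    · rw [hγ] at hp
      refine Metric.mem_thickening_iff.2 ⟨(p.1, arcHeight a b p.1),
        Or.inl (Or.inl (Or.inr ⟨abs_lt.2 hp.1, rfl⟩)), ?_⟩
      rw [Prod.dist_eq, dist_self, Real.dist_eq, hp.2]
      exact max_lt hδ (hU _ hp.1)
    · exact hself (Or.inl (Or.inr rfl))
    · have hp : γ t ∈ Set.range γ := ⟨t, rfl⟩
      rw [hγ] at hp
      refine Metric.mem_thickening_iff.2 ⟨-((γ t).1, arcHeight a b (γ t).1),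
        Or.inr ⟨by simpa using abs_lt.2 hp.1, by simp [heven]⟩, ?_⟩
      rw [dist_neg_neg, Prod.dist_eq, dist_self, Real.dist_eq, hp.2]
      exact max_lt hδ (hU _ hp.1)
  · have hmem : ∀ x, |x| < saddleX a b → (x, U x) ∈ Set.range γ := fun x hx => by
      rw [hγ]
      exact ⟨abs_lt.1 hx, rfl⟩
    rintro p (((rfl | ⟨h1, h2⟩) | rfl) | ⟨h1, h2⟩)
    · exact hself (Or.inl (Or.inl (Or.inl rfl)))
    · refine Metric.mem_thickening_iff.2 ⟨(p.1, U p.1), Or.inl (Or.inl (Or.inr (hmem _ h1))), ?_⟩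
      rw [Prod.dist_eq, dist_self, dist_comm, Real.dist_eq, h2]
      exact max_lt hδ (hU _ (abs_lt.1 h1))
    · exact hself (Or.inl (Or.inr rfl))
    · obtain ⟨t, ht⟩ := hmem (-p.1) (by rwa [abs_neg])
      refine Metric.mem_thickening_iff.2 ⟨-γ t, Or.inr ⟨t, rfl⟩, ?_⟩
      rw [ht, Prod.dist_eq, Real.dist_eq, Real.dist_eq]
      refine max_lt (by simpa using hδ) ?_
      have := hU (-p.1) (abs_lt.1 (by rwa [abs_neg]))
      rw [heven] at this
      rw [h2]
      convert! this using 2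
      simp only [Prod.snd_neg]
      ring

/-- Oddness of the field: the rotation by `π` produces the lower connection from the upper one. -/
theorem IsConnection.neg_canonicalField {p q : ℝ × ℝ} {γ : ℝ → ℝ × ℝ}
    (h : IsConnection (canonicalField a b ε d1 d2 d3 d4 d5 d6) p q γ) :
    IsConnection (canonicalField a b ε d1 d2 d3 d4 d5 d6) (-p) (-q) fun t => -γ t :=
  ⟨fun t => by rw [canonicalField_neg]; exact (h.1 t).neg, h.2.1.neg, h.2.2.neg⟩

theorem canonicalField_saddle (ha : 0 < a) (hb : b < 0) :
    canonicalField a b ε d1 d2 d3 d4 d5 d6 (rightSaddle a b) = 0 := by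
  have hr := (saddleX_pos ha hb).ne'
  rw [canonicalField_eq ha hb]
  ext
  · simp [dampedField, rightSaddle]
  · simp only [dampedField, rightSaddle, mul_zero, add_zero, Prod.snd_zero]
    field_simp
    ring

/-- The orbit from left to right alone determines `d2`. Closeness to the unperturbed loop serves
only to confine this orbit to a fixed box, where the damping is `O(ε)`. -/
theorem eq_persistenceCoeff_of_loop (ha : 0 < a) (hb : b < 0)
    (hn : IsReaction (saddleX a b) M
      (perturbReaction (arcCurvature a b) (saddleX a b) d1 d3 d4 d5 d6))
    (hε : |ε| * (8000 / (arcCurvature a b * saddleX a b) * M) ≤ 1) (hε0 : ε ≠ 0) {F : ℝ}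
    (hF : ∀ p : ℝ × ℝ, |p.1| ≤ saddleX a b + arcCurvature a b * saddleX a b ^ 2 + 1 →
      |p.2| ≤ saddleX a b + arcCurvature a b * saddleX a b ^ 2 + 1 →
      |perturbFactor d1 d2 d3 d4 d5 d6 p| ≤ F)
    (h₁ : |ε| * F ≤ 1 / 2)
    (h₂ : |ε| * F * ((4 + 4 * arcCurvature a b * saddleX a b) /
      (arcCurvature a b * saddleX a b) ^ 2) ≤ 3 / 4)
    {δ : ℝ} (hδ : δ ≤ 1) {L : Set (ℝ × ℝ)}
    (hL : IsHeteroclinicLoop (canonicalField a b ε d1 d2 d3 d4 d5 d6) (rightSaddle a b)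
      (leftSaddle a b) L) (hc : SetsClose δ L (unperturbedLoop a b)) :
    d2 = persistenceCoeff a b d1 d3 d4 d5 d6 ε := by
  obtain ⟨_, _, _, γ, _, hγ, _, rfl⟩ := hL
  rw [canonicalField_eq ha hb] at hγ
  have hb' : ∀ t, |ε * perturbFactor d1 d2 d3 d4 d5 d6 (γ t)| ≤ |ε| * F := by
    intro t
    obtain ⟨hx, hy⟩ := bound_of_mem_thickening ha hb hδ (hc.1 (Or.inl (Or.inl (Or.inr ⟨t, rfl⟩))))
    rw [abs_mul]
    exact mul_le_mul_of_nonneg_left (hF _ hx hy) (abs_nonneg ε)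
  obtain ⟨S, hS, hd⟩ := exists_profile_of_connection (saddleX_pos ha hb) (arcCurvature_pos ha hb)
    (curvature_saddle ha hb) hn hε0 hγ hb' h₁ h₂
  rw [persistenceCoeff_eq ha hb hn hε hS]
  exact hd

theorem exists_loop_of_eq_persistenceCoeff (ha : 0 < a) (hb : b < 0)
    (hn : IsReaction (saddleX a b) M
      (perturbReaction (arcCurvature a b) (saddleX a b) d1 d3 d4 d5 d6))
    (hε : |ε| * (8000 / (arcCurvature a b * saddleX a b) * M) ≤ 1) {δ : ℝ} (hδ : 0 < δ)
    (hsmall : arcCurvature a b * saddleX a b ^ 2 *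
      (2000 / (arcCurvature a b * saddleX a b) * M * |ε|) < δ)
    (hd : d2 = persistenceCoeff a b d1 d3 d4 d5 d6 ε) :
    ∃ L, IsHeteroclinicLoop (canonicalField a b ε d1 d2 d3 d4 d5 d6) (rightSaddle a b)
      (leftSaddle a b) L ∧ SetsClose δ L (unperturbedLoop a b) := by
  have hr := saddleX_pos ha hb
  have hκ := arcCurvature_pos ha hb
  have hκr := curvature_saddle ha hb
  obtain ⟨S, hS⟩ := exists_isBalancedProfile hκ hr hn hε
  rw [persistenceCoeff_eq ha hb hn hε hS] at hd
  obtain ⟨γ, hγ, hrange⟩ := exists_connection_of_profile hr hκ hκr hn hε hS hd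
  rw [← canonicalField_eq ha hb] at hγ
  have hneg : -rightSaddle a b = leftSaddle a b := by simp [rightSaddle, leftSaddle]
  have hneg' : -leftSaddle a b = rightSaddle a b := by rw [← hneg, neg_neg]
  have hX := canonicalField_saddle (d1 := d1) (d2 := d2) (d3 := d3) (d4 := d4) (d5 := d5)
    (d6 := d6) (ε := ε) ha hb
  have hγ' := hγ.neg_canonicalField
  change IsConnection _ (-leftSaddle a b) (-rightSaddle a b) _ at hγ'
  rw [hneg, hneg'] at hγ'
  refine ⟨_, ⟨(saddle_ne hr).symm, hX, ?_, γ, _, hγ, hγ', rfl⟩, ?_⟩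
  · rw [← hneg, canonicalField_neg, hX, neg_zero]
  · refine setsClose_of_graph hδ
      (U := fun x => arcProfile (arcCurvature a b) (saddleX a b) x * S x)
      (fun x hx => lt_of_le_of_lt ?_ hsmall) hrange
    have hA := arcProfile_pos hκ hx
    rw [arcHeight_eq ha hb, ← mul_sub_one, abs_mul, abs_of_pos hA]
    exact mul_le_mul (arcProfile_le hκ x) (hS.abs_sub_one_le hκ hr hn hε x hx) (abs_nonneg _)
      (by positivity)

end

/-! ### The main theorem -/

theorem mainTheorem8 (a b : ℝ) (ha : 0 < a) (hb : b < 0) :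
    (∀ d1 d2 d3 d4 d5 d6 : ℝ,
      melnikovOne a b d1 d2 d3 d4 d5 d6 =
        1 / (13860 * √2 * b ^ 4) *
          (-(198 * a ^ 6 * b * d1) + 924 * a ^ 4 * b ^ 2 * d2 - 9240 * a ^ 2 * b ^ 3 * d3
            + 1584 * a ^ 4 * b ^ 2 * d4 + 55 * a ^ 8 * d5 - 320 * a ^ 6 * b * d6)) ∧
    (∀ d1 d2 d3 d4 d5 d6 : ℝ,
      melnikovOne a b d1 d2 d3 d4 d5 d6 = 0 ↔ d2 = phiLead a b d1 d3 d4 d5 d6) ∧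
    ∃ φ₁ : ℝ → ℝ → ℝ → ℝ → ℝ → ℝ → ℝ,
      (∀ R > 0, ∃ C > 0, ∃ ε₀ > 0, ∀ d1 d3 d4 d5 d6 ε : ℝ,
        |d1| ≤ R → |d3| ≤ R → |d4| ≤ R → |d5| ≤ R → |d6| ≤ R → |ε| < ε₀ →
          |φ₁ d1 d3 d4 d5 d6 ε - phiLead a b d1 d3 d4 d5 d6| ≤ C * |ε|) ∧
      ∃ δ₀ > 0, ∀ δ : ℝ, 0 < δ → δ ≤ δ₀ → ∀ R > 0, ∃ ε₀ > 0, ∀ d1 d2 d3 d4 d5 d6 ε : ℝ,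
        |d1| ≤ R → |d2| ≤ R → |d3| ≤ R → |d4| ≤ R → |d5| ≤ R → |d6| ≤ R →
        ε ≠ 0 → |ε| < ε₀ →
          ((∃ L : Set (ℝ × ℝ),
              IsHeteroclinicLoop (canonicalField a b ε d1 d2 d3 d4 d5 d6)
                (rightSaddle a b) (leftSaddle a b) L ∧
              SetsClose δ L (unperturbedLoop a b)) ↔
            d2 = φ₁ d1 d3 d4 d5 d6 ε) := by
  have hr := saddleX_pos ha hb
  have hκ := arcCurvature_pos ha hb
  have hκr := curvature_saddle ha hb
  refine ⟨melnikovOne_eq ha hb, melnikovOne_eq_zero_iff ha hb, persistenceCoeff a b, ?_, 1,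
    one_pos, ?_⟩
  · intro R hR
    set r := saddleX a b
    set κ := arcCurvature a b
    set M := R * (80 * (1 + r ^ 4 + r ^ 6 + (κ * r ^ 2) ^ 2 + (κ * r ^ 2) ^ 4))
    have hM : 0 < M := by positivity
    refine ⟨480000 * M ^ 2 / (κ * r ^ 3), by positivity, (8000 / (κ * r) * M)⁻¹, by positivity, ?_⟩
    intro d1 d3 d4 d5 d6 ε h1 h3 h4 h5 h6 hε
    have hε1 : |ε| * (8000 / (κ * r) * M) ≤ 1 := by
      rw [← le_div_iff₀ (by positivity), one_div]
      exact hε.le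
    have hn := isReaction_perturbReaction hr hκ h1 h3 h4 h5 h6
    obtain ⟨S, hS⟩ := exists_isBalancedProfile hκ hr hn hε1
    rw [persistenceCoeff_eq ha hb hn hε1 hS, ← balanceCoeff_one ha hb]
    exact hS.abs_balanceCoeff_sub_one_le hκ hr hn hε1
  · intro δ hδ hδ1 R hR
    set r := saddleX a b
    set κ := arcCurvature a b
    set M := R * (80 * (1 + r ^ 4 + r ^ 6 + (κ * r ^ 2) ^ 2 + (κ * r ^ 2) ^ 4))
    have hM : 0 < M := by positivity
    set F := 6 * R * (r + κ * r ^ 2 + 1) ^ 6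
    have hF : 0 < F := by positivity
    -- Four smallness conditions on `|ε|`: contraction, damping at most `1/2`, the a priori bound
    -- that puts `S` in `[1/2, 2]`, and `δ`-closeness. The factor `2` in `c₄` yields the strict
    -- inequality.
    set c₁ := 8000 / (κ * r) * M
    set c₂ := 2 * F
    set c₃ := 2 * F * ((4 + 4 * κ * r) / (κ * r) ^ 2)
    set c₄ := 2 * (κ * r ^ 2 * (2000 / (κ * r) * M)) / δ
    have hc₁ : 0 < c₁ := by positivity
    have hc₂ : 0 < c₂ := by positivity
    have hc₃ : 0 < c₃ := by positivity
    have hc₄ : 0 < c₄ := by positivity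
    refine ⟨(c₁ + c₂ + c₃ + c₄)⁻¹, by positivity, ?_⟩
    intro d1 d2 d3 d4 d5 d6 ε h1 h2 h3 h4 h5 h6 hε0 hε
    have hεc : |ε| * (c₁ + c₂ + c₃ + c₄) ≤ 1 := by
      rw [← le_div_iff₀ (by positivity), one_div]
      exact hε.le
    have he := abs_nonneg ε
    have hε1 : |ε| * c₁ ≤ 1 := by
      linarith [mul_nonneg he hc₂.le, mul_nonneg he hc₃.le, mul_nonneg he hc₄.le]
    have hε2 : |ε| * c₂ ≤ 1 := by
      linarith [mul_nonneg he hc₁.le, mul_nonneg he hc₃.le, mul_nonneg he hc₄.le]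
    have hε3 : |ε| * c₃ ≤ 1 := by
      linarith [mul_nonneg he hc₁.le, mul_nonneg he hc₂.le, mul_nonneg he hc₄.le]
    have hε4 : |ε| * c₄ ≤ 1 := by
      linarith [mul_nonneg he hc₁.le, mul_nonneg he hc₂.le, mul_nonneg he hc₃.le]
    have hn := isReaction_perturbReaction hr hκ h1 h3 h4 h5 h6
    constructor
    · rintro ⟨L, hL, hc⟩
      refine eq_persistenceCoeff_of_loop ha hb hn hε1 hε0 (F := F)
        (fun p hx hy => abs_perturbFactor_le
          (by linarith [mul_pos hκ (pow_pos hr 2)]) h1 h2 h3 h4 h5 h6 hx hy)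
        (by simp only [c₂] at hε2; linarith) (by simp only [c₃] at hε3; linarith) hδ1 hL hc
    · refine exists_loop_of_eq_persistenceCoeff ha hb hn hε1 hδ ?_
      calc κ * r ^ 2 * (2000 / (κ * r) * M * |ε|) = |ε| * c₄ * δ / 2 := by
            simp only [c₄]; field_simp
        _ ≤ 1 * δ / 2 := by gcongr
        _ < δ := by linarith
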